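/- **The network.** The DHV network has three stations and six job classes. Jobs arrive at rate $\alpha_1$ to class 1, follow the route $1\to2\to3\to4\to5\to6$ and then leave; classes $1,4$ are served at station 1, classes $2,5$ at station 2, classes $3,6$ at station 3, with mean service times $m_k>0$. Write $s(k)$ for the station of class $k$, $C\in\{0,1\}^{3\times 6}$ for the constituency matrix ($C_{jk}=1$ iff $s(k)=j$), $M=\mathrm{diag}(m_1,\dots,m_6)$, $P$ for the routing matrix, $\alpha=(\alpha_1,0,\dots,0)'$, and $\rho=CM(I-P')^{-1}\alpha$ for the traffic intensities. The network is balanced, normalized so that $m_1+m_4=m_2+m_5=m_3+m_6=1$ (then $\rho_1=\rho_2=\rho_3=\alpha_1$). **Queue-ratio policies and their fluid model.** A ratio matrix is a matrix $\Delta\in\mathbb R_+^{6\times 3}$ with $\Delta_{kj}=0$ whenever $s(k)\ne j$ and $CM\Delta=I$. A fluid solution for $\Delta$ is a pair of functions $Z,T:[0,\infty)\to\mathbb R^6$, with $Z(t)\ge 0$, such that, with $W(t)=CMZ(t)$, $\epsilon(t)=Z(t)-\Delta W(t)$ and $Y(t)=et-CT(t)$ (where $e=(1,1,1)'$): $Z(t)=Z(0)+\alpha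 t-(I-P')M^{-1}T(t)$; $T(0)=0$; all components of $T$ and of $Y$ are nondecreasing; $\int_0^\infty W_j(s)\,dY_j(s)=0$ for every station $j$; and for every class $k$ and all $t\ge0$, $\int_0^t\epsilon_k^+(s)\,d(s-T_k^+(s))=0$, where $\epsilon_k^+=\sum_{i\le k,\ s(i)=s(k)}\mathbf 1\{\epsilon_i>0\}\,\epsilon_i$ and $dT_k^+=\sum_{i\le k,\ s(i)=s(k)}\mathbf 1\{\epsilon_i>0\}\,dT_i$ (a server works at full rate on classes with $\epsilon>0$, lowest index first; in this network at most one class per station has $\epsilon>0$ at any time, so the tie-breaking rule is immaterial). State-space collapse holds for $\Delta$ if for every initial condition $z_0$ there is $t_0\ge 0$ such that every fluid solution with $Z(0)=z_0$ satisfies $Z(t)=\Delta W(t)$ for all $t\ge t_0$. **Statement.** For all $m_1,\dots,m_6>0$ with $m_1+m_4=m_2+m_5=m_3+m_6=1$ there exists $\bar\alpha\in(0,1)$, depending only on $M$, such that if $\alpha_1>\bar\alpha$ and 1. the nominal-load conditions $\rho_1,\rho_2,\rho_3<1$ hold (equivalently, $\alpha_1<1$), 2. $m_2+m_4+m_6<2$,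 then state-space collapse holds for every ratio matrix $\Delta$, that is, under every queue-ratio policy. -/

import Mathlib

open MeasureTheory Set Matrix

noncomputable section

/-! ### Multiclass queueing networks -/

/-- The primitives `(C, M, P, α)` of an open multiclass queueing network with `J` stations and `K`
classes.  Stations and classes are numbered from `0`. -/
structure MulticlassNetwork (J K : ℕ) where
  /-- the station `s(k)` at which class `k` is served -/
  station : Fin K → Fin J
  /-- the mean service times `m_k` -/
  m : Fin K → ℝ
  m_pos : ∀ k, 0 < m k
  /-- the routing matrix: a class-`k` job becomes a class-`l` job with probability `P k l` -/
  P : Matrix (Fin K) (Fin K) ℝ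
  P_nonneg : ∀ k l, 0 ≤ P k l
  P_row_sum_le_one : ∀ k, ∑ l, P k l ≤ 1
  /-- the network is open: `I + P + P² + …` converges -/
  P_summable : Summable fun n : ℕ => P ^ n
  /-- the exogenous arrival rates -/
  α : Fin K → ℝ
  α_nonneg : ∀ k, 0 ≤ α k

namespace MulticlassNetwork

variable {J K : ℕ} (N : MulticlassNetwork J K)

/-- The constituency matrix. -/
def C : Matrix (Fin J) (Fin K) ℝ := Matrix.of fun j k => if N.station k = j then 1 else 0

/-- The diagonal matrix of mean service times. -/
def M : Matrix (Fin K) (Fin K) ℝ := Matrix.diagonal N.m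

/-- The diagonal matrix of service rates `μ_k = 1 / m_k`, which is `M⁻¹`. -/
def Minv : Matrix (Fin K) (Fin K) ℝ := Matrix.diagonal fun k => 1 / N.m k

/-- `Q = (I - P')⁻¹`. -/
def Q : Matrix (Fin K) (Fin K) ℝ := (1 - N.Pᵀ)⁻¹

/-- The effective arrival rates `λ = Q α`. -/
def effectiveRate : Fin K → ℝ := N.Q *ᵥ N.α

/-- The traffic intensities `ρ = C M λ`. -/
def trafficIntensity : Fin J → ℝ := (N.C * N.M) *ᵥ N.effectiveRate

/-- The nominal-load conditions `ρ_j < 1` for every station `j`. -/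
def NominalLoad : Prop := ∀ j, N.trafficIntensity j < 1

/-- Ratio matrices: nonnegative `K × J` matrices `Δ`, with `Δ k j = 0` unless class `k` is served at
station `j`, and `C M Δ = I`. -/
structure IsRatioMatrix (Δ : Matrix (Fin K) (Fin J) ℝ) : Prop where
  nonneg : ∀ k j, 0 ≤ Δ k j
  support : ∀ k j, N.station k ≠ j → Δ k j = 0
  proportions : N.C * N.M * Δ = 1

/-! ### The fluid model of a queue-ratio policy -/

/-- The workload `W = C M Z`. -/
def workload (Z : ℝ → Fin K → ℝ) (t : ℝ) : Fin J → ℝ := (N.C * N.M) *ᵥ Z t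

/-- The imbalance `ε = Z - Δ W`, that is `ε_k = Z_k - δ_k W_{s(k)}`. -/
def imbalance (Δ : Matrix (Fin K) (Fin J) ℝ) (Z : ℝ → Fin K → ℝ) (t : ℝ) : Fin K → ℝ :=
  Z t - Δ *ᵥ N.workload Z t

/-- The cumulative idle time `Y = e t - C T`. -/
def idleTime (T : ℝ → Fin K → ℝ) (t : ℝ) : Fin J → ℝ := (fun _ => t) - N.C *ᵥ T t

/-- `ε_k^+(t)`: the sum of `ε_i(t)` over the classes `i ≤ k` of the station of `k` that have
`ε_i(t) > 0`. -/
def imbalancePlus (Δ : Matrix (Fin K) (Fin J) ℝ) (Z : ℝ → Fin K → ℝ) (k : Fin K) (t : ℝ) : ℝ :=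
  ∑ i with i ≤ k ∧ N.station i = N.station k,
    if 0 < N.imbalance Δ Z t i then N.imbalance Δ Z t i else 0

end MulticlassNetwork

/-- Extending a function that is nondecreasing on `[0, ∞)` by its value at `0`. -/
theorem monotone_comp_max_zero {f : ℝ → ℝ} (hf : MonotoneOn f (Ici 0)) :
    Monotone fun t => f (max t 0) := fun _ _ h =>
  hf (mem_Ici.2 (le_max_right _ _)) (mem_Ici.2 (le_max_right _ _)) (max_le_max_right 0 h)

/-- The Lebesgue–Stieltjes measure `df` of a function `f` that is nondecreasing on `[0, ∞)`. -/
def lebesgueStieltjes {f : ℝ → ℝ} (hf : MonotoneOn f (Ici 0)) : Measure ℝ :=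
  (monotone_comp_max_zero hf).stieltjesFunction.measure

namespace MulticlassNetwork

variable {J K : ℕ} (N : MulticlassNetwork J K)

/-- `(Z, T)` solves the fluid model equations of the queue-ratio policy with ratio matrix `Δ`; the
functions of time matter on `[0, ∞)` only. -/
structure IsFluidSolution (Δ : Matrix (Fin K) (Fin J) ℝ) (Z T : ℝ → Fin K → ℝ) : Prop where
  /-- fluid levels are nonnegative -/
  Z_nonneg : ∀ t, 0 ≤ t → ∀ k, 0 ≤ Z t k
  /-- `Z(t) = Z(0) + α t - (I - P') M⁻¹ T(t)` -/
  balance : ∀ t, 0 ≤ t → Z t = Z 0 + t • N.α - ((1 - N.Pᵀ) * N.Minv) *ᵥ T t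
  T_zero : T 0 = 0
  T_mono : ∀ k, MonotoneOn (fun t => T t k) (Ici 0)
  Y_mono : ∀ j, MonotoneOn (fun t => N.idleTime T t j) (Ici 0)
  /-- a server idles only if its station is empty: `∫₀^∞ W_j dY_j = 0` -/
  nonidling : ∀ j, ∫⁻ s in Ici (0 : ℝ), ENNReal.ofReal (N.workload Z s j)
      ∂(lebesgueStieltjes (Y_mono j)) = 0
  /-- a server works at full rate on the classes with `ε > 0`, lowest index first:
  `∫₀ᵗ ε_k^+(s) d(s - T_k^+(s)) = 0`, where `dT_k^+ = ∑ 1{ε_i > 0} dT_i`, the sum running over the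
  classes `i ≤ k` of the station of `k` -/
  priority : ∀ k, ∀ t, 0 ≤ t →
    ∫⁻ s in Icc 0 t, ENNReal.ofReal (N.imbalancePlus Δ Z k s) =
      ∑ i with i ≤ k ∧ N.station i = N.station k,
        ∫⁻ s in Icc 0 t ∩ {s | 0 < N.imbalance Δ Z s i},
          ENNReal.ofReal (N.imbalancePlus Δ Z k s) ∂(lebesgueStieltjes (T_mono i))

/-- State-space collapse under the queue-ratio policy with ratio matrix `Δ`: there is a time `t₀`,
depending on the initial condition only, such that every fluid solution satisfies
`Z(t) = Δ W(t)` for all `t ≥ t₀`. -/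
def StateSpaceCollapse (Δ : Matrix (Fin K) (Fin J) ℝ) : Prop :=
  ∀ z₀ : Fin K → ℝ, ∃ t₀ : ℝ, 0 ≤ t₀ ∧
    ∀ Z T : ℝ → Fin K → ℝ, N.IsFluidSolution Δ Z T → Z 0 = z₀ →
      ∀ t, t₀ ≤ t → Z t = Δ *ᵥ N.workload Z t

end MulticlassNetwork

/-! ### The Dai–Hasenbein–Vande Vate network -/

/-- The routing `1 → 2 → 3 → 4 → 5 → 6 → exit` (numbered from `0` here). -/
def dhvRouting : Matrix (Fin 6) (Fin 6) ℝ :=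
  Matrix.of fun k l => if (l : ℕ) = k + 1 then 1 else 0

theorem dhvRouting_pow_six : dhvRouting ^ 6 = 0 := by
  have h : dhvRouting = (Nat.castRingHom ℝ).mapMatrix
      (Matrix.of fun k l : Fin 6 => if (l : ℕ) = k + 1 then 1 else 0) := by
    ext k l
    simp [dhvRouting]
  have h0 : (Matrix.of fun k l : Fin 6 => if (l : ℕ) = k + 1 then (1 : ℕ) else 0) ^ 6 = 0 := by
    decide +kernel
  rw [h, ← map_pow, h0, map_zero]

/-- The DHV network: three stations, six classes, arrivals at rate `α₁` to the first class only.
Classes 1 and 4 are served at station 1, classes 2 and 5 at station 2, classes 3 and 6 at station 3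
(classes and stations are numbered from `0` here). -/
def dhvNetwork (m : Fin 6 → ℝ) (hm : ∀ k, 0 < m k) (α₁ : ℝ) (hα₁ : 0 ≤ α₁) :
    MulticlassNetwork 3 6 where
  station := ![0, 1, 2, 0, 1, 2]
  m := m
  m_pos := hm
  P := dhvRouting
  P_nonneg k l := by
    simp only [dhvRouting, Matrix.of_apply]
    split_ifs <;> norm_num
  P_row_sum_le_one k := by
    fin_cases k <;> simp [dhvRouting] <;> decide
  P_summable := by
    refine summable_of_ne_finset_zero (s := Finset.range 6) fun n hn => ?_
    obtain ⟨i, rfl⟩ := Nat.exists_eq_add_of_le (not_lt.1 (fun h => hn (Finset.mem_range.2 h)))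
    rw [pow_add, dhvRouting_pow_six, zero_mul]
  α := Pi.single 0 α₁
  α_nonneg k := by
    by_cases h : k = 0
    · subst h; simpa using hα₁
    · simp [h]

end

/-! Each station is described by one scalar `x`, the work by which its first-visit class exceeds its
proportion `p`; collapse means that all three `x` vanish. The Lyapunov function sums `A / (1 - p) *
x⁺ + B / p * x⁻` over the stations. Dividing by `1 - p` and `p` makes the drift bounds free of the
ratio matrix: a class in excess gets the whole server, and inflow to the other class of the station
only helps, so the drift is at most weight times (work inflow of the class minus 1).

The inflows are departure rates of other classes. A station with `x ≠ 0` has known departure rates;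
one with `x = 0` is stationary and, when busy, works at full rate, so it passes shortages on.
`total_drift_le` uses this to bound the total drift by `-1` for every sign pattern except all zeros,
given the finite system `LyapunovWeights`. Only patterns with `x₁ = 0` and nothing in excess but
class 5 or 6 need `α₁` close to 1.

Solving that system (`exists_lyapunovWeights`) is where `m₂ + m₄ + m₆ < 2` enters: classes 2, 4, 6
feed one another's excess in a cycle, and the condition keeps the cycle from amplifying. The
analytic lemmas turn the integral complementarity conditions into these rates at almost every time
(`dhv_stationRates`). The function then decreases at rate 1 until it vanishes
(`eq_zero_of_ae_deriv_le_neg_one`). -/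

/-! ### Departure rates of a single station -/

/-- The departure rates `d`, `e` of the two classes of a station with mean service times `μ`, `ν`,
arrival rates `a`, `b` and imbalance `x`, under the policy with proportion `p`. -/
structure StationRates (μ ν p x a b d e : ℝ) : Prop where
  d_nonneg : 0 ≤ d
  e_nonneg : 0 ≤ e
  capacity : μ * d + ν * e ≤ 1
  of_pos : 0 < x → μ * d = 1
  of_neg : x < 0 → ν * e = 1
  stationary : x = 0 → (1 - p) * (μ * (a - d)) = p * (ν * (b - e))
  busy_or_empty : x = 0 → μ * d + ν * e = 1 ∨ (d = a ∧ e = b)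

/-- Applied to the work accumulation rates of the two classes: a station that stays balanced cannot
drain one class while the other grows. -/
theorem not_neg_and_pos_of_convex {p X Y : ℝ} (hp : 0 ≤ p) (hp' : p ≤ 1)
    (h : (1 - p) * X = p * Y) : ¬ (X < 0 ∧ 0 < Y) := by
  rintro ⟨hX, hY⟩
  rcases hp.eq_or_lt with rfl | hp
  · linarith
  · nlinarith [mul_pos hp hY, mul_nonneg (sub_nonneg.2 hp') (neg_pos.2 hX).le]

namespace StationRates

variable {μ ν p x a b d e : ℝ}

theorem le_inv (h : StationRates μ ν p x a b d e) (hμ : 0 < μ) (hν : 0 < ν) : d ≤ 1 / μ := by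
  rw [le_div_iff₀ hμ]
  nlinarith [h.capacity, mul_nonneg hν.le h.e_nonneg]

theorem le_inv' (h : StationRates μ ν p x a b d e) (hμ : 0 < μ) (hν : 0 < ν) : e ≤ 1 / ν := by
  rw [le_div_iff₀ hν]
  nlinarith [h.capacity, mul_nonneg hμ.le h.d_nonneg]

theorem eq_of_pos (h : StationRates μ ν p x a b d e) (hμ : 0 < μ) (hν : 0 < ν) (hx : 0 < x) :
    d = 1 / μ ∧ e = 0 := by
  have h1 := h.of_pos hx
  refine ⟨by rw [eq_div_iff hμ.ne']; linarith, le_antisymm ?_ h.e_nonneg⟩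
  by_contra! he
  nlinarith [h.capacity, mul_pos hν he]

theorem eq_of_neg (h : StationRates μ ν p x a b d e) (hμ : 0 < μ) (hν : 0 < ν) (hx : x < 0) :
    d = 0 ∧ e = 1 / ν := by
  have h1 := h.of_neg hx
  refine ⟨le_antisymm ?_ h.d_nonneg, by rw [eq_div_iff hν.ne']; linarith⟩
  by_contra! hd
  nlinarith [h.capacity, mul_pos hμ hd]

/-- A balanced station passes a shortage of low class arrivals on. -/
theorem le_one_of_zero (h : StationRates μ ν p x a b d e) (hμ : 0 < μ) (hν : 0 < ν)
    (hμν : μ + ν = 1) (hp : 0 ≤ p) (hp' : p ≤ 1) (hx : x = 0) (ha : a ≤ 1) (hb : 1 ≤ b) :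
    d ≤ 1 ∧ 1 ≤ e := by
  rcases h.busy_or_empty hx with hc | ⟨rfl, rfl⟩
  · have hd : d ≤ 1 := by
      by_contra! hd
      have he : e < 1 := by nlinarith
      exact not_neg_and_pos_of_convex hp hp' (h.stationary hx)
        ⟨by nlinarith, by nlinarith⟩
    exact ⟨hd, by nlinarith⟩
  · exact ⟨ha, hb⟩

/-- A balanced station passes a shortage of high class arrivals on. -/
theorem one_le_of_zero (h : StationRates μ ν p x a b d e) (hμ : 0 < μ) (hν : 0 < ν)
    (hμν : μ + ν = 1) (hp : 0 ≤ p) (hp' : p ≤ 1) (hx : x = 0) (ha : 1 ≤ a) (hb : b ≤ 1) :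
    1 ≤ d ∧ e ≤ 1 := by
  rcases h.busy_or_empty hx with hc | ⟨rfl, rfl⟩
  · have hd : 1 ≤ d := by
      by_contra! hd
      have he : 1 < e := by nlinarith
      refine not_neg_and_pos_of_convex hp hp' (X := - (μ * (a - d))) (Y := - (ν * (b - e))) ?_
        ⟨by nlinarith, by nlinarith⟩
      linarith [h.stationary hx]
    exact ⟨hd, by nlinarith⟩
  · exact ⟨ha, hb⟩

/-- If `d < a ≤ 1`, full capacity forces `e > 1 ≥ b`: one class would grow while the other drains.
-/
theorem ge_of_zero (h : StationRates μ ν p x a b d e) (hμ : 0 < μ) (hν : 0 < ν)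
    (hμν : μ + ν = 1) (hp : 0 ≤ p) (hp' : p ≤ 1) (hx : x = 0) (ha : a ≤ 1) (hb : b ≤ 1) :
    a ≤ d := by
  rcases h.busy_or_empty hx with hc | ⟨rfl, rfl⟩
  · by_contra! hd
    have he : 1 < e := by nlinarith
    refine not_neg_and_pos_of_convex hp hp' (X := - (μ * (a - d))) (Y := - (ν * (b - e))) ?_
      ⟨by nlinarith, by nlinarith⟩
    linarith [h.stationary hx]
  · exact le_rfl

/-- The low class may run below rate 1 by the shortage `1 - a`, and the capacity freed raises the
high rate by at most `y`. This is how the deficit `1 - α₁` is controlled. -/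
theorem le_add_of_zero {y : ℝ} (h : StationRates μ ν p x a b d e) (hν : 0 < ν)
    (hμν : μ + ν = 1) (hp : 0 ≤ p) (hp' : p ≤ 1) (hx : x = 0) (ha : μ * (1 - a) ≤ ν * y)
    (hb : b ≤ 1 + y) : e ≤ 1 + y := by
  rcases h.busy_or_empty hx with hc | ⟨rfl, rfl⟩
  · by_contra! he
    refine not_neg_and_pos_of_convex hp hp' (X := - (μ * (a - d))) (Y := - (ν * (b - e))) ?_
      ⟨by nlinarith, by nlinarith⟩
    linarith [h.stationary hx]
  · exact hb

end StationRates

/-! ### Lyapunov weights and the drift -/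

/-- The weights `A j` of the positive parts and `B j` of the negative parts of the imbalances, for
which the weighted total imbalance decreases at rate `1`. -/
structure LyapunovWeights (m₁ m₂ m₃ m₄ m₅ m₆ A₁ A₂ A₃ B₁ B₂ B₃ : ℝ) : Prop where
  A₁_pos : 0 < A₁
  A₂_ge : 1 ≤ A₂ * m₅
  A₃_ge : 1 ≤ A₃ * m₆
  B₁_ge : 1 ≤ B₁ * m₁
  B₂_ge : 1 ≤ B₂ * (m₂ / 2)
  B₃_ge : 1 ≤ B₃ * (m₃ / 2)
  pos_any_any : A₂ * (m₂ / m₁) + B₂ * (m₅ / m₄) + A₃ * (m₃ / m₂) + B₃ * (m₆ / m₅) ≤ A₁ * m₄ - 1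
  neg_zero_pos : B₁ * (m₄ / m₃ - 1) ≤ A₃ * m₆ - 1
  neg_neg_pos : B₁ * (m₄ / m₃ - 1) + B₂ * (m₅ / m₄ - 1) ≤ A₃ - 1
  neg_pos_pos : A₃ * (m₃ / m₂ - 1) + B₁ * (m₄ / m₃ - 1) ≤ A₂ - 1
  neg_neg_neg : B₂ * (m₅ / m₄ - 1) + B₃ * (m₆ / m₅ - 1) ≤ B₁ - 1
  neg_zero_neg : B₃ * (m₆ / m₅ - 1) ≤ B₁ - 1
  neg_pos_zero : B₁ * (m₄ / m₃ - 1) ≤ A₂ - 1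
  neg_neg_zero : B₂ * (m₅ / m₄ - 1) ≤ B₁ * m₁ - 1
  zero_pos_pos : A₃ * (m₃ / m₂ - 1) ≤ A₂ * m₅ - 1
  zero_pos_neg : A₂ * (m₂ / m₁ - 1) ≤ B₃ - 1
  zero_neg_pos : B₂ * (m₅ / m₄ - 1) ≤ A₃ - 1
  zero_neg_neg : B₃ * (m₆ / m₅ - 1) ≤ B₂ * (m₂ / 2) - 1

/-- The bound on the rate of change of the weighted imbalance of a station. -/
noncomputable def stationDrift (A B μ ν x a b : ℝ) : ℝ :=
  if 0 < x then A * (μ * a - 1) else if x < 0 then B * (ν * b - 1) else 0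

theorem stationDrift_of_pos {A B μ ν x a b : ℝ} (hx : 0 < x) :
    stationDrift A B μ ν x a b = A * (μ * a - 1) := if_pos hx

theorem stationDrift_of_neg {A B μ ν x a b : ℝ} (hx : x < 0) :
    stationDrift A B μ ν x a b = B * (ν * b - 1) := by
  rw [stationDrift, if_neg hx.not_gt, if_pos hx]

theorem stationDrift_of_zero {A B μ ν x a b : ℝ} (hx : x = 0) :
    stationDrift A B μ ν x a b = 0 := by
  simp [stationDrift, hx]

theorem stationDrift_le {A B μ ν x a b a' b' : ℝ} (hA : 0 ≤ A) (hB : 0 ≤ B) (hμ : 0 ≤ μ)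
    (hν : 0 ≤ ν) (ha' : 0 ≤ a') (hb' : 0 ≤ b') (ha : a ≤ a') (hb : b ≤ b') :
    stationDrift A B μ ν x a b ≤ A * (μ * a') + B * (ν * b') := by
  have h1 : A * (μ * a) ≤ A * (μ * a') := by gcongr
  have h2 : B * (ν * b) ≤ B * (ν * b') := by gcongr
  have h3 : 0 ≤ A * (μ * a') := by positivity
  have h4 : 0 ≤ B * (ν * b') := by positivity
  unfold stationDrift
  split_ifs <;> linarith

/-- The sign patterns of `(x₁, x₂, x₃)` are checked one by one; the later fields of
`LyapunovWeights` are named after the pattern that needs them. A ratio such as `m₄ / m₃` is the work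
inflow to class 4 when class 3 has its server to itself. -/
theorem total_drift_le {m₁ m₂ m₃ m₄ m₅ m₆ A₁ A₂ A₃ B₁ B₂ B₃ p₁ p₂ p₃ x₁ x₂ x₃ α y
    d₁ d₂ d₃ d₄ d₅ d₆ : ℝ} (h : LyapunovWeights m₁ m₂ m₃ m₄ m₅ m₆ A₁ A₂ A₃ B₁ B₂ B₃)
    (h₁ : 0 < m₁) (h₂ : 0 < m₂) (h₃ : 0 < m₃) (h₄ : 0 < m₄) (h₅ : 0 < m₅) (h₆ : 0 < m₆)
    (h₁₄ : m₁ + m₄ = 1) (h₂₅ : m₂ + m₅ = 1) (h₃₆ : m₃ + m₆ = 1)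
    (hp₁ : 0 ≤ p₁) (hp₁' : p₁ ≤ 1) (hp₂ : 0 ≤ p₂) (hp₂' : p₂ ≤ 1) (hp₃ : 0 ≤ p₃) (hp₃' : p₃ ≤ 1)
    (hα : α ≤ 1) (hy : 0 ≤ y) (hy₁ : m₁ * (1 - α) ≤ m₄ * y) (hy₂ : m₂ * (1 - α) ≤ m₅ * y)
    (hy₅ : m₅ * y ≤ m₂ / 2) (hy₆ : m₆ * y ≤ m₃ / 2)
    (r₁ : StationRates m₁ m₄ p₁ x₁ α d₃ d₁ d₄) (r₂ : StationRates m₂ m₅ p₂ x₂ d₁ d₄ d₂ d₅)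
    (r₃ : StationRates m₃ m₆ p₃ x₃ d₂ d₅ d₃ d₆) (hx : ¬ (x₁ = 0 ∧ x₂ = 0 ∧ x₃ = 0)) :
    stationDrift A₁ B₁ m₁ m₄ x₁ α d₃ + stationDrift A₂ B₂ m₂ m₅ x₂ d₁ d₄ +
      stationDrift A₃ B₃ m₃ m₆ x₃ d₂ d₅ ≤ -1 := by
  have hA₁ := h.A₁_pos
  have hA₂ : 0 < A₂ := pos_of_mul_pos_left (zero_lt_one.trans_le h.A₂_ge) h₅.le
  have hA₃ : 0 < A₃ := pos_of_mul_pos_left (zero_lt_one.trans_le h.A₃_ge) h₆.le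
  have hB₁ : 0 < B₁ := pos_of_mul_pos_left (zero_lt_one.trans_le h.B₁_ge) h₁.le
  have hB₂ : 0 < B₂ := pos_of_mul_pos_left (zero_lt_one.trans_le h.B₂_ge) (half_pos h₂).le
  have hB₃ : 0 < B₃ := pos_of_mul_pos_left (zero_lt_one.trans_le h.B₃_ge) (half_pos h₃).le
  have inv_ge {u v : ℝ} (hu : 0 < u) (hv : 0 < v) (huv : u + v = 1) : 1 ≤ 1 / u := by
    rw [le_div_iff₀ hu]; linarith
  have i₂ := inv_ge h₂ h₅ h₂₅
  have i₃ := inv_ge h₃ h₆ h₃₆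
  have i₄ := inv_ge h₄ h₁ (by linarith)
  have i₅ := inv_ge h₅ h₂ (by linarith)
  have mono {A u s t : ℝ} (hA : 0 < A) (hu : 0 < u) (hst : s ≤ t) :
      A * (u * s - 1) ≤ A * (u * t - 1) := by gcongr
  have k₁ : A₁ * m₁ = A₁ - A₁ * m₄ := by linear_combination A₁ * h₁₄
  have k₂ : A₂ * m₂ = A₂ - A₂ * m₅ := by linear_combination A₂ * h₂₅
  have k₃ : A₃ * m₃ = A₃ - A₃ * m₆ := by linear_combination A₃ * h₃₆
  have k₄ : B₁ * m₄ = B₁ - B₁ * m₁ := by linear_combination B₁ * h₁₄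
  have k₅ : B₂ * m₅ = B₂ - B₂ * m₂ := by linear_combination B₂ * h₂₅
  have k₆ : B₃ * m₆ = B₃ - B₃ * m₃ := by linear_combination B₃ * h₃₆
  have k₇ : B₁ * m₁ ≤ B₁ := mul_le_of_le_one_right hB₁.le (by linarith)
  have k₈ : B₂ * (m₅ * y) ≤ B₂ * (m₂ / 2) := mul_le_mul_of_nonneg_left hy₅ hB₂.le
  have k₉ : B₃ * (m₆ * y) ≤ B₃ * (m₃ / 2) := mul_le_mul_of_nonneg_left hy₆ hB₃.le
  rcases lt_trichotomy x₁ 0 with n₁ | z₁ | c₁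
  · obtain ⟨e₁, e₄⟩ := r₁.eq_of_neg h₁ h₄ n₁
    rw [stationDrift_of_neg n₁]
    rcases lt_trichotomy x₂ 0 with n₂ | z₂ | c₂
    · obtain ⟨e₂, e₅⟩ := r₂.eq_of_neg h₂ h₅ n₂
      rw [stationDrift_of_neg n₂, e₄, mul_one_div]
      rcases lt_trichotomy x₃ 0 with n₃ | z₃ | c₃
      · rw [stationDrift_of_neg n₃, (r₃.eq_of_neg h₃ h₆ n₃).1, e₅, mul_one_div]
        linarith [h.neg_neg_neg]
      · rw [stationDrift_of_zero z₃]
        have := (r₃.le_one_of_zero h₃ h₆ h₃₆ hp₃ hp₃' z₃ (by linarith) (by linarith)).1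
        have := mono hB₁ h₄ this
        linarith [h.neg_neg_zero]
      · rw [stationDrift_of_pos c₃, (r₃.eq_of_pos h₃ h₆ c₃).1, e₂, mul_one_div]
        linarith [h.neg_neg_pos]
    · rw [stationDrift_of_zero z₂]
      obtain ⟨l₂, l₅⟩ := r₂.le_one_of_zero h₂ h₅ h₂₅ hp₂ hp₂' z₂ (by linarith) (by linarith)
      rcases lt_trichotomy x₃ 0 with n₃ | z₃ | c₃
      · rw [stationDrift_of_neg n₃, (r₃.eq_of_neg h₃ h₆ n₃).1]
        have := mono hB₃ h₆ (r₂.le_inv' h₂ h₅)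
        rw [mul_one_div] at this
        linarith [h.neg_zero_neg]
      · rw [stationDrift_of_zero z₃]
        have := mono hB₁ h₄ (r₃.le_one_of_zero h₃ h₆ h₃₆ hp₃ hp₃' z₃ l₂ l₅).1
        linarith [h.B₁_ge]
      · rw [stationDrift_of_pos c₃, (r₃.eq_of_pos h₃ h₆ c₃).1, mul_one_div]
        have := mono hA₃ h₃ l₂
        linarith [h.neg_zero_pos]
    · obtain ⟨e₂, e₅⟩ := r₂.eq_of_pos h₂ h₅ c₂
      rw [stationDrift_of_pos c₂, e₁]
      rcases lt_trichotomy x₃ 0 with n₃ | z₃ | c₃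
      -- All three excess classes (4, 2, 6) are starved, since their predecessors 3, 1, 5 receive no
      -- service.
      · rw [stationDrift_of_neg n₃, (r₃.eq_of_neg h₃ h₆ n₃).1, e₅]
        linarith [h.B₁_ge]
      · rw [stationDrift_of_zero z₃]
        have := mono hB₁ h₄ (r₃.le_inv h₃ h₆)
        rw [mul_one_div] at this
        linarith [h.neg_pos_zero]
      · rw [stationDrift_of_pos c₃, (r₃.eq_of_pos h₃ h₆ c₃).1, e₂, mul_one_div, mul_one_div]
        linarith [h.neg_pos_pos]
  · rw [stationDrift_of_zero z₁]
    rcases lt_trichotomy x₂ 0 with n₂ | z₂ | c₂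
    · obtain ⟨e₂, e₅⟩ := r₂.eq_of_neg h₂ h₅ n₂
      rw [stationDrift_of_neg n₂]
      rcases lt_trichotomy x₃ 0 with n₃ | z₃ | c₃
      · rw [stationDrift_of_neg n₃, e₅, mul_one_div]
        have e₃ := (r₃.eq_of_neg h₃ h₆ n₃).1
        -- Class 4 receives nothing here, so class 5 has inflow at most `1 + y`. Its drift is at
        -- most `B₂ * (m₅ * y - m₂) ≤ -B₂ * m₂ / 2`, whence the halves in the weight conditions.
        have := mono hB₂ h₅ (r₁.le_add_of_zero h₄ h₁₄ hp₁ hp₁' z₁ hy₁ (by linarith))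
        linarith [h.zero_neg_neg]
      · rw [stationDrift_of_zero z₃]
        have l₃ := (r₃.le_one_of_zero h₃ h₆ h₃₆ hp₃ hp₃' z₃ (by linarith) (by linarith)).1
        have := mono hB₂ h₅ (r₁.le_add_of_zero h₄ h₁₄ hp₁ hp₁' z₁ hy₁ (by linarith))
        linarith [h.B₂_ge]
      · rw [stationDrift_of_pos c₃, e₂]
        have := mono hB₂ h₅ (r₁.le_inv' h₁ h₄)
        rw [mul_one_div] at this
        linarith [h.zero_neg_pos]
    · rw [stationDrift_of_zero z₂]
      rcases lt_trichotomy x₃ 0 with n₃ | z₃ | c₃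
      · rw [stationDrift_of_neg n₃]
        have e₃ := (r₃.eq_of_neg h₃ h₆ n₃).1
        have l₄ := r₁.le_add_of_zero h₄ h₁₄ hp₁ hp₁' z₁ hy₁ (by linarith)
        -- The deficit crosses two balanced stations: station 1 passes on at least `α` to class 2
        -- and at most `1 + y` to class 5, so station 2 passes at most `1 + y` to class 6.
        have l₁ := r₁.ge_of_zero h₁ h₄ h₁₄ hp₁ hp₁' z₁ hα (by linarith)
        have := mono hB₃ h₆
          (r₂.le_add_of_zero h₅ h₂₅ hp₂ hp₂' z₂ ((mul_le_mul_of_nonneg_left (by linarith) h₂.le).trans hy₂) l₄)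
        linarith [h.B₃_ge]
      · exact absurd ⟨z₁, z₂, z₃⟩ hx
      · rw [stationDrift_of_pos c₃]
        have e₃ := (r₃.eq_of_pos h₃ h₆ c₃).1
        obtain ⟨l₁, l₄⟩ := r₁.le_one_of_zero h₁ h₄ h₁₄ hp₁ hp₁' z₁ hα (by linarith)
        have := mono hA₃ h₃ (r₂.le_one_of_zero h₂ h₅ h₂₅ hp₂ hp₂' z₂ l₁ l₄).1
        linarith [h.A₃_ge]
    · obtain ⟨e₂, e₅⟩ := r₂.eq_of_pos h₂ h₅ c₂
      rw [stationDrift_of_pos c₂]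
      rcases lt_trichotomy x₃ 0 with n₃ | z₃ | c₃
      · rw [stationDrift_of_neg n₃, e₅]
        have := mono hA₂ h₂ (r₁.le_inv h₁ h₄)
        rw [mul_one_div] at this
        linarith [h.zero_pos_neg]
      · rw [stationDrift_of_zero z₃]
        have l₃ := (r₃.one_le_of_zero h₃ h₆ h₃₆ hp₃ hp₃' z₃ (by linarith) (by linarith)).1
        have := mono hA₂ h₂ (r₁.le_one_of_zero h₁ h₄ h₁₄ hp₁ hp₁' z₁ hα l₃).1
        linarith [h.A₂_ge]
      · rw [stationDrift_of_pos c₃, e₂, mul_one_div]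
        have e₃ := (r₃.eq_of_pos h₃ h₆ c₃).1
        have := mono hA₂ h₂ (r₁.le_one_of_zero h₁ h₄ h₁₄ hp₁ hp₁' z₁ hα (by linarith)).1
        linarith [h.zero_pos_pos]
  · rw [stationDrift_of_pos c₁]
    -- Class 1 has inflow at most 1, so its term is at most `-A₁ * m₄`; with `A₁` large, crude
    -- bounds on the other stations suffice.
    have u₂ := stationDrift_le (x := x₂) hA₂.le hB₂.le h₂.le h₅.le (one_div_pos.2 h₁).le
      (one_div_pos.2 h₄).le (r₁.le_inv h₁ h₄) (r₁.le_inv' h₁ h₄)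
    have u₃ := stationDrift_le (x := x₃) hA₃.le hB₃.le h₃.le h₆.le (one_div_pos.2 h₂).le
      (one_div_pos.2 h₅).le (r₂.le_inv h₂ h₅) (r₂.le_inv' h₂ h₅)
    simp only [mul_one_div] at u₂ u₃
    have := mono hA₁ h₁ hα
    linarith [h.pos_any_any]

/-- The inequalities bound weights in terms of one another. If `m₂ ≤ m₁` or `m₆ ≤ m₅`, a dependence
drops out and the weights can be chosen successively. Otherwise the cycle `B₁`, `A₂`, `B₃` remains
and needs the condition on `m₂ + m₄ + m₆`. -/
theorem exists_lyapunovWeights {m₁ m₂ m₃ m₄ m₅ m₆ : ℝ}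
    (h₁ : 0 < m₁) (h₂ : 0 < m₂) (h₃ : 0 < m₃) (h₄ : 0 < m₄) (h₅ : 0 < m₅) (h₆ : 0 < m₆)
    (h₁₄ : m₁ + m₄ = 1) (h₂₅ : m₂ + m₅ = 1) (h₃₆ : m₃ + m₆ = 1) (h₂₄₆ : m₂ + m₄ + m₆ < 2) :
    ∃ A₁ A₂ A₃ B₁ B₂ B₃, LyapunovWeights m₁ m₂ m₃ m₄ m₅ m₆ A₁ A₂ A₃ B₁ B₂ B₃ := by
  -- Apart from its positivity, `A₁` occurs only in `pos_any_any`, so it can be chosen last.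
  suffices H : ∃ A₂ A₃ B₁ B₂ B₃ : ℝ, 1 ≤ A₂ * m₅ ∧ 1 ≤ A₃ * m₆ ∧ 1 ≤ B₁ * m₁ ∧
      1 ≤ B₂ * (m₂ / 2) ∧ 1 ≤ B₃ * (m₃ / 2) ∧ B₁ * (m₄ / m₃ - 1) ≤ A₃ * m₆ - 1 ∧
      B₁ * (m₄ / m₃ - 1) + B₂ * (m₅ / m₄ - 1) ≤ A₃ - 1 ∧
      A₃ * (m₃ / m₂ - 1) + B₁ * (m₄ / m₃ - 1) ≤ A₂ - 1 ∧
      B₂ * (m₅ / m₄ - 1) + B₃ * (m₆ / m₅ - 1) ≤ B₁ - 1 ∧ B₃ * (m₆ / m₅ - 1) ≤ B₁ - 1 ∧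
      B₁ * (m₄ / m₃ - 1) ≤ A₂ - 1 ∧ B₂ * (m₅ / m₄ - 1) ≤ B₁ * m₁ - 1 ∧
      A₃ * (m₃ / m₂ - 1) ≤ A₂ * m₅ - 1 ∧ A₂ * (m₂ / m₁ - 1) ≤ B₃ - 1 ∧
      B₂ * (m₅ / m₄ - 1) ≤ A₃ - 1 ∧ B₃ * (m₆ / m₅ - 1) ≤ B₂ * (m₂ / 2) - 1 by
    obtain ⟨A₂, A₃, B₁, B₂, B₃, a₂, a₃, b₁, b₂, b₃, k₁, k₂, k₃, k₄, k₅, k₆, k₇, k₈, k₉, k₁₀,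
      k₁₁⟩ := H
    have hA₂ : 0 < A₂ := pos_of_mul_pos_left (zero_lt_one.trans_le a₂) h₅.le
    have hA₃ : 0 < A₃ := pos_of_mul_pos_left (zero_lt_one.trans_le a₃) h₆.le
    have hB₂ : 0 < B₂ := pos_of_mul_pos_left (zero_lt_one.trans_le b₂) (half_pos h₂).le
    have hB₃ : 0 < B₃ := pos_of_mul_pos_left (zero_lt_one.trans_le b₃) (half_pos h₃).le
    refine ⟨(A₂ * (m₂ / m₁) + B₂ * (m₅ / m₄) + A₃ * (m₃ / m₂) + B₃ * (m₆ / m₅) + 1) / m₄,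
      A₂, A₃, B₁, B₂, B₃, by positivity, a₂, a₃, b₁, b₂, b₃, ?_, k₁, k₂, k₃, k₄, k₅, k₆, k₇, k₈,
      k₉, k₁₀, k₁₁⟩
    rw [div_mul_cancel₀ _ h₄.ne']
    linarith
  have mulabs {B : ℝ} (hB : 0 < B) (u : ℝ) : B * u ≤ B * |u| := by gcongr; exact le_abs_self u
  have pabs {B : ℝ} (hB : 0 < B) (u : ℝ) : 0 ≤ B * |u| := by positivity
  have nonpos {B u : ℝ} (hB : 0 < B) (hu : u ≤ 0) : B * u ≤ 0 :=
    mul_nonpos_of_nonneg_of_nonpos hB.le hu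
  set u := m₄ / m₃ - 1 with hu
  set v := m₅ / m₄ - 1 with hv
  set w := m₃ / m₂ - 1 with hw
  set y := m₆ / m₅ - 1 with hy
  set z := m₂ / m₁ - 1 with hz
  -- Solves `B * c = s` for the new weight; since `c ≤ 1`, also `s ≤ B`, so one choice serves the
  -- constraints on `B * c` and those on `B`.
  have shrink {c B s : ℝ} (hc : 0 < c) (hc1 : c ≤ 1) (hs : 0 < s) (hB : B = s / c) :
      0 < B ∧ B * c = s ∧ s ≤ B := by
    subst hB
    refine ⟨by positivity, div_mul_cancel₀ _ hc.ne', ?_⟩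
    rw [le_div_iff₀ hc]
    nlinarith
  rcases le_total m₂ m₁ with c₂₁ | c₂₁
  -- Now `A₂` no longer bounds `B₃` from below, so the order `B₃`, `B₂`, `B₁`, `A₃`, `A₂` works.
  · have hz0 : z ≤ 0 := by rw [hz, sub_nonpos, div_le_one h₁]; exact c₂₁
    obtain ⟨B₃, hB₃⟩ : ∃ B, B = 1 / (m₃ / 2) := ⟨_, rfl⟩
    obtain ⟨p₁, q₁, s₁⟩ := shrink (by linarith) (by linarith) one_pos hB₃
    obtain ⟨B₂, hB₂⟩ : ∃ B, B = (B₃ * |y| + 1) / (m₂ / 2) := ⟨_, rfl⟩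
    obtain ⟨p₂, q₂, s₂⟩ := shrink (by linarith) (by linarith) (by positivity) hB₂
    obtain ⟨B₁, hB₁⟩ : ∃ B, B = (B₂ * |v| + B₃ * |y| + 1) / m₁ := ⟨_, rfl⟩
    obtain ⟨p₃, q₃, s₃⟩ := shrink (by linarith) (by linarith) (by positivity) hB₁
    obtain ⟨A₃, hA₃⟩ : ∃ B, B = (B₁ * |u| + B₂ * |v| + 1) / m₆ := ⟨_, rfl⟩
    obtain ⟨p₄, q₄, s₄⟩ := shrink (by linarith) (by linarith) (by positivity) hA₃
    obtain ⟨A₂, hA₂⟩ : ∃ B, B = (A₃ * |w| + B₁ * |u| + 1) / m₅ := ⟨_, rfl⟩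
    obtain ⟨p₅, q₅, s₅⟩ := shrink (by linarith) (by linarith) (by positivity) hA₂
    have t₁ := mulabs p₁ y
    have t₂ := mulabs p₂ v
    have t₃ := mulabs p₃ u
    have t₄ := mulabs p₄ w
    have t₅ := nonpos p₅ hz0
    have t₆ := pabs p₁ y
    have t₇ := pabs p₂ v
    have t₈ := pabs p₃ u
    have t₉ := pabs p₄ w
    refine ⟨A₂, A₃, B₁, B₂, B₃, ?_⟩
    refine ⟨?_, ?_, ?_, ?_, ?_, ?_, ?_, ?_, ?_, ?_, ?_, ?_, ?_, ?_, ?_, ?_⟩ <;> linarith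
  have hv0 : v ≤ 0 := by rw [hv, sub_nonpos, div_le_one h₄]; linarith
  rcases le_total m₆ m₅ with c₆₅ | c₆₅
  -- Now `B₃` bounds neither `B₁` nor `B₂` from below and can be chosen last.
  · have hy0 : y ≤ 0 := by rw [hy, sub_nonpos, div_le_one h₅]; exact c₆₅
    obtain ⟨B₂, hB₂⟩ : ∃ B, B = 1 / (m₂ / 2) := ⟨_, rfl⟩
    obtain ⟨p₁, q₁, s₁⟩ := shrink (by linarith) (by linarith) one_pos hB₂
    obtain ⟨B₁, hB₁⟩ : ∃ B, B = 1 / m₁ := ⟨_, rfl⟩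
    obtain ⟨p₂, q₂, s₂⟩ := shrink (by linarith) (by linarith) one_pos hB₁
    obtain ⟨A₃, hA₃⟩ : ∃ B, B = (B₁ * |u| + 1) / m₆ := ⟨_, rfl⟩
    obtain ⟨p₃, q₃, s₃⟩ := shrink (by linarith) (by linarith) (by positivity) hA₃
    obtain ⟨A₂, hA₂⟩ : ∃ B, B = (A₃ * |w| + B₁ * |u| + 1) / m₅ := ⟨_, rfl⟩
    obtain ⟨p₄, q₄, s₄⟩ := shrink (by linarith) (by linarith) (by positivity) hA₂
    obtain ⟨B₃, hB₃⟩ : ∃ B, B = (A₂ * |z| + 1) / (m₃ / 2) := ⟨_, rfl⟩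
    obtain ⟨p₅, q₅, s₅⟩ := shrink (by linarith) (by linarith) (by positivity) hB₃
    have t₁ := nonpos p₁ hv0
    have t₂ := mulabs p₂ u
    have t₃ := mulabs p₃ w
    have t₄ := mulabs p₄ z
    have t₅ := nonpos p₅ hy0
    have t₆ := pabs p₂ u
    have t₇ := pabs p₃ w
    have t₈ := pabs p₄ z
    refine ⟨A₂, A₃, B₁, B₂, B₃, ?_⟩
    refine ⟨?_, ?_, ?_, ?_, ?_, ?_, ?_, ?_, ?_, ?_, ?_, ?_, ?_, ?_, ?_, ?_⟩ <;> linarith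
  · have hw0 : w ≤ 0 := by rw [hw, sub_nonpos, div_le_one h₂]; linarith
    -- By balance, `σ = m₁ - (m₆ - m₅) = m₅ - (m₄ - m₃) = m₃ - (m₂ - m₁)`. With `B₁ = K * m₁ * m₃`,
    -- `A₂ = K * m₁ * m₅`, `B₃ = K * m₃ * m₅`, each inequality of the cycle therefore has a gap that
    -- is a positive multiple of `K * σ`.
    obtain ⟨σ, hσ⟩ : ∃ σ, σ = 2 - m₂ - m₄ - m₆ := ⟨_, rfl⟩
    have σpos : 0 < σ := by linarith
    have σle : σ ≤ 1 := by linarith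
    -- The first three terms make the cycle gaps at least 1; the last three give `B₁ * m₁ ≥ 1`, `B₃
    -- * (m₃ / 2) ≥ 1` and `A₂ * m₅ ≥ 1`.
    obtain ⟨K, hK⟩ : ∃ K, K = 1 / (m₃ * σ) + 1 / (m₁ * σ) + 1 / (m₅ * σ) + 1 / (m₁ ^ 2 * m₃) +
      2 / (m₃ ^ 2 * m₅) + 1 / (m₁ * m₅ ^ 2) := ⟨_, rfl⟩
    have f₁ : 0 < 1 / (m₃ * σ) := by positivity
    have f₂ : 0 < 1 / (m₁ * σ) := by positivity
    have f₃ : 0 < 1 / (m₅ * σ) := by positivity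
    have f₄ : 0 < 1 / (m₁ ^ 2 * m₃) := by positivity
    have f₅ : 0 < 2 / (m₃ ^ 2 * m₅) := by positivity
    have f₆ : 0 < 1 / (m₁ * m₅ ^ 2) := by positivity
    have g₁ : 1 ≤ K * (m₃ * σ) := (div_le_iff₀ (by positivity)).1 (by linarith)
    have g₂ : 1 ≤ K * (m₁ * σ) := (div_le_iff₀ (by positivity)).1 (by linarith)
    have g₃ : 1 ≤ K * (m₅ * σ) := (div_le_iff₀ (by positivity)).1 (by linarith)
    have g₄ : 1 ≤ K * (m₁ ^ 2 * m₃) := (div_le_iff₀ (by positivity)).1 (by linarith)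
    have g₅ : 2 ≤ K * (m₃ ^ 2 * m₅) := (div_le_iff₀ (by positivity)).1 (by linarith)
    have g₆ : 1 ≤ K * (m₁ * m₅ ^ 2) := (div_le_iff₀ (by positivity)).1 (by linarith)
    have Kpos : 0 < K := by linarith
    have pB₁ : 0 < K * m₁ * m₃ := by positivity
    have pA₂ : 0 < K * m₁ * m₅ := by positivity
    have pB₃ : 0 < K * m₃ * m₅ := by positivity
    obtain ⟨B₂, hB₂⟩ : ∃ B, B = (K * m₃ * m₅ * |y| + 1) / (m₂ / 2) := ⟨_, rfl⟩
    obtain ⟨p₂, q₂, s₂⟩ := shrink (by linarith) (by linarith) (by positivity) hB₂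
    obtain ⟨A₃, hA₃⟩ : ∃ B, B = (K * m₁ * m₃ * |u| + 1) / m₆ := ⟨_, rfl⟩
    obtain ⟨p₃, q₃, s₃⟩ := shrink (by linarith) (by linarith) (by positivity) hA₃
    have t₁ := nonpos p₂ hv0
    have t₂ := nonpos p₃ hw0
    have t₃ := mulabs pB₃ y
    have t₄ := mulabs pB₁ u
    have t₅ := pabs pB₃ y
    have t₆ := pabs pB₁ u
    have e₁ : K * m₃ * m₅ * y = K * m₁ * m₃ - K * (m₃ * σ) := by
      rw [hy, hσ]
      field_simp
      linarith
    have e₂ : K * m₁ * m₃ * u = K * m₁ * m₅ - K * (m₁ * σ) := by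
      rw [hu, hσ]
      field_simp
      linarith
    have e₃ : K * m₁ * m₅ * z = K * m₃ * m₅ - K * (m₅ * σ) := by
      rw [hz, hσ]
      field_simp
      linarith
    have e₄ : 1 ≤ K * m₁ * m₃ * m₁ := by linarith
    have e₅ : K * m₁ * m₃ * m₁ ≤ K * m₁ * m₃ := mul_le_of_le_one_right pB₁.le (by linarith)
    have e₆ : 1 ≤ K * m₁ * m₅ * m₅ := by linarith
    refine ⟨K * m₁ * m₅, A₃, K * m₁ * m₃, B₂, K * m₃ * m₅, ?_⟩
    refine ⟨?_, ?_, ?_, ?_, ?_, ?_, ?_, ?_, ?_, ?_, ?_, ?_, ?_, ?_, ?_, ?_⟩ <;> linarith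

/-! ### Derivatives of monotone functions and of positive parts -/

/-- A monotone function with equal values at the endpoints of an interval is stationary inside. -/
theorem hasDerivAt_zero_of_monotoneOn {g : ℝ → ℝ} {a b t : ℝ} (hg : MonotoneOn g (Icc a b))
    (hab : g a = g b) (ht : t ∈ Ioo a b) : HasDerivAt g 0 t := by
  refine (hasDerivAt_const t (g a)).congr_of_eventuallyEq ?_
  filter_upwards [Ioo_mem_nhds ht.1 ht.2] with s hs
  have hle : a ≤ b := (ht.1.trans ht.2).le
  have hs' := Ioo_subset_Icc_self hs
  exact le_antisymm ((hg hs' (right_mem_Icc.2 hle) hs'.2).trans hab.ge)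
    (hg (left_mem_Icc.2 hle) hs' hs'.1)

theorem HasDerivAt.nonneg_of_monotoneOn_Ici {g : ℝ → ℝ} {g' t : ℝ} (h : HasDerivAt g g' t)
    (hg : MonotoneOn g (Ici 0)) (ht : 0 < t) : 0 ≤ g' := by
  have := (hg.mono interior_subset).derivWithin_nonneg (x := t)
  rw [interior_Ici, derivWithin_of_isOpen isOpen_Ioi ht, h.deriv] at this
  exact this

theorem HasDerivAt.eq_zero_of_nonneg {g : ℝ → ℝ} {g' t : ℝ} (h : HasDerivAt g g' t)
    (hg : ∀ᶠ s in nhds t, 0 ≤ g s) (h0 : g t = 0) : g' = 0 :=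
  IsLocalMin.hasDerivAt_eq_zero (by filter_upwards [hg] with s hs; rw [h0]; exact hs) h

/-- Where `f t ≤ 0` the positive part is at its minimum, so its derivative, assumed to exist, is 0.
-/
theorem hasDerivAt_max_zero {f : ℝ → ℝ} {f' t : ℝ} (h : HasDerivAt f f' t)
    (hm : DifferentiableAt ℝ (fun s => max (f s) 0) t) :
    HasDerivAt (fun s => max (f s) 0) (if 0 < f t then f' else 0) t := by
  rcases lt_or_ge 0 (f t) with h0 | h0
  · rw [if_pos h0]
    refine h.congr_of_eventuallyEq ?_
    filter_upwards [h.continuousAt.eventually (lt_mem_nhds h0)] with s hs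
    exact max_eq_left hs.le
  · rw [if_neg h0.not_gt]
    have := hm.hasDerivAt
    rwa [this.eq_zero_of_nonneg (.of_forall fun s => le_max_right _ _) (max_eq_right h0)] at this

/-! ### The Lyapunov function of one station -/

/-- The contribution of a station with imbalance `x` to the Lyapunov function. -/
noncomputable def stationLyapunov (A B p x : ℝ) : ℝ := A / (1 - p) * max x 0 + B / p * max (-x) 0

theorem stationLyapunov_nonneg {A B p x : ℝ} (hA : 0 ≤ A) (hB : 0 ≤ B) (hp : 0 ≤ p) (hp' : p ≤ 1) :
    0 ≤ stationLyapunov A B p x := by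
  have := sub_nonneg.2 hp'
  unfold stationLyapunov
  positivity

/-- For `p = 0` or `p = 1` one coefficient is a division by zero, hence 0; `h0` and `h1` say that
the part of `x` it would weigh vanishes anyway. -/
theorem eq_zero_of_stationLyapunov_eq_zero {A B p x : ℝ} (hA : 0 < A) (hB : 0 < B) (hp : 0 ≤ p)
    (hp' : p ≤ 1) (h0 : p = 0 → 0 ≤ x) (h1 : p = 1 → x ≤ 0) (h : stationLyapunov A B p x = 0) :
    x = 0 := by
  have hq := sub_nonneg.2 hp'
  have n₁ : 0 ≤ A / (1 - p) * max x 0 := by positivity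
  have n₂ : 0 ≤ B / p * max (-x) 0 := by positivity
  unfold stationLyapunov at h
  rcases lt_trichotomy x 0 with hx | hx | hx
  · have : 0 < p := hp.lt_of_ne fun e => (h0 e.symm).not_gt hx
    have : 0 < B / p * max (-x) 0 := by
      rw [max_eq_left (by linarith)]
      have := neg_pos.2 hx
      positivity
    linarith
  · exact hx
  · have : 0 < 1 - p := hq.lt_of_ne fun e => (h1 (by linarith)).not_gt hx
    have : 0 < A / (1 - p) * max x 0 := by
      rw [max_eq_left hx.le]
      positivity
    linarith

/-- The rates and the drift of a station, from the behaviour of the fluid levels `Z₁`, `Z₂` of its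
two classes and of the time allocations at a time of differentiability. -/
theorem stationRates_of_hasDerivAt {A B μ ν p a b τ₁ τ₂ t : ℝ} {Z₁ Z₂ x : ℝ → ℝ}
    (hA : 0 ≤ A) (hB : 0 ≤ B) (hμ : 0 < μ) (hν : 0 < ν) (hp : 0 ≤ p) (hp' : p ≤ 1)
    (ha : 0 ≤ a) (hb : 0 ≤ b)
    (hx : x = fun s => (1 - p) * (μ * Z₁ s) - p * (ν * Z₂ s))
    (hZ₁ : HasDerivAt Z₁ (a - τ₁ / μ) t) (hZ₂ : HasDerivAt Z₂ (b - τ₂ / ν) t)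
    (nn₁ : ∀ᶠ s in nhds t, 0 ≤ Z₁ s) (nn₂ : ∀ᶠ s in nhds t, 0 ≤ Z₂ s)
    (hτ₁ : 0 ≤ τ₁) (hτ₂ : 0 ≤ τ₂) (hτ : τ₁ + τ₂ ≤ 1)
    (busy : 0 < μ * Z₁ t + ν * Z₂ t → τ₁ + τ₂ = 1)
    (hpos : 0 < x t → τ₁ = 1) (hneg : x t < 0 → τ₂ = 1)
    (d₁ : DifferentiableAt ℝ (fun s => max (x s) 0) t)
    (d₂ : DifferentiableAt ℝ (fun s => max (-x s) 0) t) :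
    StationRates μ ν p (x t) a b (τ₁ / μ) (τ₂ / ν) ∧
      ∃ L', HasDerivAt (fun s => stationLyapunov A B p (x s)) L' t ∧
        L' ≤ stationDrift A B μ ν (x t) a b := by
  have hZ₁0 := nn₁.self_of_nhds
  have hZ₂0 := nn₂.self_of_nhds
  have e₁ : μ * (τ₁ / μ) = τ₁ := mul_div_cancel₀ _ hμ.ne'
  have e₂ : ν * (τ₂ / ν) = τ₂ := mul_div_cancel₀ _ hν.ne'
  have hx' : HasDerivAt x ((1 - p) * (μ * (a - τ₁ / μ)) - p * (ν * (b - τ₂ / ν))) t := by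
    rw [hx]
    exact ((hZ₁.const_mul μ).const_mul (1 - p)).sub ((hZ₂.const_mul ν).const_mul p)
  have D₁ := hasDerivAt_max_zero hx' d₁
  have D₂ := hasDerivAt_max_zero hx'.neg d₂
  constructor
  · refine ⟨by positivity, by positivity, by rwa [e₁, e₂], by rwa [e₁], by rwa [e₂], fun h0 => ?_,
      fun h0 => ?_⟩
    -- Both parts of `x` are at their minimum when `x t = 0`, so `x = x⁺ - x⁻` has derivative 0.
    · have D : HasDerivAt x _ t := (D₁.sub D₂).congr_of_eventuallyEq <| .of_forall fun s => by
        show x s = max (x s) 0 - max (-x s) 0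
        rcases le_total 0 (x s) with h | h
        · rw [max_eq_left h, max_eq_right (by linarith)]; ring
        · rw [max_eq_right h, max_eq_left (by linarith)]; ring
      simp only [h0, Pi.neg_apply, neg_zero, lt_irrefl, if_false, sub_zero] at D
      linarith [hx'.unique D]
    · rw [e₁, e₂]
      rcases (show 0 ≤ μ * Z₁ t + ν * Z₂ t by positivity).eq_or_lt with h | h
      · right
        have z₁ : Z₁ t = 0 := by nlinarith [mul_nonneg hμ.le hZ₁0, mul_nonneg hν.le hZ₂0]
        have z₂ : Z₂ t = 0 := by nlinarith [mul_nonneg hμ.le hZ₁0, mul_nonneg hν.le hZ₂0]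
        exact ⟨by linarith [hZ₁.eq_zero_of_nonneg nn₁ z₁], by linarith [hZ₂.eq_zero_of_nonneg nn₂ z₂]⟩
      · exact .inl (busy h)
  · refine ⟨_, (D₁.const_mul (A / (1 - p))).add (D₂.const_mul (B / p)), ?_⟩
    have hxt : x t = (1 - p) * (μ * Z₁ t) - p * (ν * Z₂ t) := congrFun hx t
    have hq := sub_nonneg.2 hp'
    simp only [Pi.neg_apply, neg_pos]
    rcases lt_trichotomy (x t) 0 with h | h | h
    · have hp0 : 0 < p := hp.lt_of_ne fun e => by
        rw [← e] at hxt
        nlinarith [mul_nonneg hμ.le hZ₁0]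
      have t₁ : τ₁ = 0 := by linarith [hneg h]
      rw [if_neg h.not_gt, if_pos h, stationDrift_of_neg h, mul_zero, zero_add, t₁, hneg h,
        zero_div, sub_zero, mul_sub ν, mul_one_div_cancel hν.ne']
      -- The subtracted term is the inflow to the other class; dropping it leaves a bound without
      -- `p`.
      have : B / p * -((1 - p) * (μ * a) - p * (ν * b - 1)) =
          B * (ν * b - 1) - B / p * ((1 - p) * (μ * a)) := by field_simp; ring
      rw [this, sub_le_self_iff]
      positivity
    · simp [h, stationDrift_of_zero]
    · have hp0 : 0 < 1 - p := hq.lt_of_ne fun e => by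
        rw [← e, show p = 1 by linarith] at hxt
        nlinarith [mul_nonneg hν.le hZ₂0]
      have t₂ : τ₂ = 0 := by linarith [hpos h]
      rw [if_pos h, if_neg h.not_gt, stationDrift_of_pos h, mul_zero, add_zero, t₂, hpos h,
        zero_div, sub_zero, mul_sub μ, mul_one_div_cancel hμ.ne']
      have : A / (1 - p) * ((1 - p) * (μ * a - 1) - p * (ν * b)) =
          A * (μ * a - 1) - A / (1 - p) * (p * (ν * b)) := by field_simp
      rw [this, sub_le_self_iff]
      positivity

/-! ### Lipschitz functions decreasing at unit rate -/

theorem LipschitzOnWith.ae_differentiableAt_of_pos {K : NNReal} {f : ℝ → ℝ}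
    (h : LipschitzOnWith K f (Ici 0)) : ∀ᵐ t, 0 < t → DifferentiableAt ℝ f t := by
  filter_upwards [h.ae_differentiableWithinAt_of_mem_real] with t ht h0
  exact (ht h0.le).differentiableAt (Ici_mem_nhds h0)

/-- A nonnegative Lipschitz function that decreases at rate `1` as long as it is positive vanishes
from the time `f 0` on. -/
theorem eq_zero_of_ae_deriv_le_neg_one {K : NNReal} {f : ℝ → ℝ} (hf : LipschitzOnWith K f (Ici 0))
    (nn : ∀ t, 0 ≤ t → 0 ≤ f t)
    (hd : ∀ᵐ t, 0 < t → ∀ f', HasDerivAt f f' t → 0 < f t → f' ≤ -1) {t : ℝ} (ht : f 0 ≤ t) :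
    f t = 0 := by
  have key {c a b : ℝ} (ha : 0 ≤ a) (hab : a ≤ b)
      (H : ∀ᵐ s, s ∈ Icc a b → 0 < s → deriv f s ≤ c) : f b - f a ≤ c * (b - a) := by
    have ac : AbsolutelyContinuousOnInterval f a b :=
      (hf.mono (by rw [uIcc_of_le hab]; exact fun s hs => ha.trans hs.1)).absolutelyContinuousOnInterval
    rw [← ac.integral_deriv_eq_sub, show c * (b - a) = ∫ _ in a..b, c by simp [mul_comm]]
    refine intervalIntegral.integral_mono_ae_restrict hab ac.intervalIntegrable_deriv
      intervalIntegrable_const ?_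
    rw [Filter.EventuallyLE, ae_restrict_iff' measurableSet_Icc]
    have : ∀ᵐ s : ℝ, s ≠ 0 := by simp [ae_iff, measure_singleton]
    filter_upwards [H, this] with s hs hs0 hm
    exact hs hm ((ha.trans hm.1).lt_of_ne hs0.symm)
  have hdiff := hf.ae_differentiableAt_of_pos
  -- At a zero `f` is minimal and its derivative is 0, so the derivative is nonpositive almost
  -- everywhere. Thus positivity at `t` spreads back over `[0, t]`.
  have anti {a b : ℝ} (ha : 0 ≤ a) (hab : a ≤ b) : f b ≤ f a := by
    have := key (c := 0) ha hab <| by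
      filter_upwards [hd, hdiff] with s h1 h2 _ hs0
      rcases (nn s hs0.le).eq_or_lt with h | h
      · refine ((h2 hs0).hasDerivAt.eq_zero_of_nonneg ?_ h.symm).le
        filter_upwards [lt_mem_nhds hs0] with r hr using nn r hr.le
      · linarith [h1 hs0 _ (h2 hs0).hasDerivAt h]
    linarith
  have ht0 : 0 ≤ t := (nn 0 le_rfl).trans ht
  refine le_antisymm (not_lt.1 fun hpos => ?_) (nn t ht0)
  have := key (c := -1) le_rfl ht0 <| by
    filter_upwards [hd, hdiff] with s h1 h2 hs hs0
    exact h1 hs0 _ (h2 hs0).hasDerivAt (hpos.trans_le (anti hs.1 hs.2))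
  linarith

/-! ### From integral complementarity conditions to derivatives -/

theorem lebesgueStieltjes_Ioc {f : ℝ → ℝ} (hf : MonotoneOn f (Ici 0)) (hc : ContinuousOn f (Ici 0))
    {a b : ℝ} (ha : 0 ≤ a) (hab : a ≤ b) :
    lebesgueStieltjes hf (Ioc a b) = ENNReal.ofReal (f b - f a) := by
  have hcont : Continuous fun t => f (max t 0) :=
    hc.comp_continuous (by fun_prop) fun t => mem_Ici.2 (le_max_right _ _)
  rw [lebesgueStieltjes, StieltjesFunction.measure_Ioc, Monotone.stieltjesFunction_eq,
    Monotone.stieltjesFunction_eq, hcont.continuousWithinAt.rightLim_eq,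
    hcont.continuousWithinAt.rightLim_eq, max_eq_left ha, max_eq_left (ha.trans hab)]

/-- The Lebesgue–Stieltjes measure of a function that grows at rate at most `1` is dominated by the
Lebesgue measure. -/
theorem exists_lebesgueStieltjes_add_eq_volume {f : ℝ → ℝ} (hf : MonotoneOn f (Ici 0))
    (hc : ContinuousOn f (Ici 0)) (h1 : ∀ a b, 0 ≤ a → a ≤ b → f b - f a ≤ b - a) :
    ∃ ν : Measure ℝ, lebesgueStieltjes hf + ν = volume := by
  have hcont : Continuous fun t => f (max t 0) :=
    hc.comp_continuous (by fun_prop) fun t => mem_Ici.2 (le_max_right _ _)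
  -- The complementary measure is that of `t - f t`, nondecreasing because `f` grows at rate at most
  -- 1.
  let G : StieltjesFunction ℝ :=
    { toFun := fun t => t - f (max t 0)
      mono' := fun a b hab => by
        have := h1 (max a 0) (max b 0) (le_max_right _ _) (max_le_max_right 0 hab)
        have : max b 0 - max a 0 ≤ b - a := by
          rcases le_total a 0 with ha | ha <;> rcases le_total b 0 with hb | hb <;>
            simp [ha, hb] <;> linarith
        dsimp only
        linarith
      right_continuous' := fun t => (continuous_id.sub hcont).continuousWithinAt }
  refine ⟨G.measure, ?_⟩
  rw [lebesgueStieltjes, ← StieltjesFunction.measure_add, Real.volume_eq_stieltjes_id]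
  congr 1
  ext t
  show Function.rightLim _ t + (t - f (max t 0)) = t
  rw [hcont.continuousWithinAt.rightLim_eq]
  ring

theorem measure_Icc_eq_zero_of_setLIntegral {ν : Measure ℝ} {F : ℝ → ENNReal} {S : Set ℝ}
    {a b c : ℝ} (h : ∫⁻ s in S, F s ∂ν = 0) (hS : Icc a b ⊆ S) (hc : 0 < c)
    (hF : ∀ s ∈ Icc a b, ENNReal.ofReal c ≤ F s) : ν (Icc a b) = 0 := by
  have : ENNReal.ofReal c * ν (Icc a b) ≤ 0 := by
    rw [← h, ← setLIntegral_const]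
    exact (setLIntegral_mono' measurableSet_Icc hF).trans (lintegral_mono_set hS)
  simpa [hc.not_ge] using this

theorem exists_Icc_half_le {g : ℝ → ℝ} (hg : ContinuousOn g (Ici 0)) {t : ℝ} (ht : 0 < t)
    (h : 0 < g t) : ∃ a b, 0 ≤ a ∧ a < t ∧ t < b ∧ ∀ s ∈ Icc a b, g t / 2 ≤ g s := by
  have hev : ∀ᶠ s in nhds t, g t / 2 < g s :=
    (hg.continuousAt (Ici_mem_nhds ht)).eventually (lt_mem_nhds (half_lt_self h))
  obtain ⟨ε, hε, hb⟩ := Metric.eventually_nhds_iff_ball.1 hev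
  refine ⟨max 0 (t - ε / 2), t + ε / 2, le_max_left _ _, max_lt ht (by linarith), by linarith,
    fun s hs => (hb s ?_).le⟩
  rw [Real.ball_eq_Ioo]
  exact ⟨by linarith [hs.1, le_max_right 0 (t - ε / 2)], by linarith [hs.2]⟩

/-- If `∫ w dy = 0` then `y` is stationary where `w > 0`. -/
theorem hasDerivAt_zero_of_lintegral_eq_zero {w y : ℝ → ℝ} (hy : MonotoneOn y (Ici 0))
    (hyc : ContinuousOn y (Ici 0)) (hw : ContinuousOn w (Ici 0))
    (h : ∫⁻ s in Ici 0, ENNReal.ofReal (w s) ∂(lebesgueStieltjes hy) = 0) {t : ℝ} (ht : 0 < t)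
    (hwt : 0 < w t) : HasDerivAt y 0 t := by
  obtain ⟨a, b, ha, hat, htb, hab⟩ := exists_Icc_half_le hw ht hwt
  have h0 := measure_Icc_eq_zero_of_setLIntegral h (fun s hs => ha.trans hs.1) (half_pos hwt)
    (fun s hs => ENNReal.ofReal_le_ofReal (hab s hs))
  have h1 := measure_mono_null Ioc_subset_Icc_self h0
  rw [lebesgueStieltjes_Ioc hy hyc ha (hat.trans htb).le, ENNReal.ofReal_eq_zero] at h1
  exact hasDerivAt_zero_of_monotoneOn (hy.mono fun s hs => ha.trans hs.1)
    (le_antisymm (hy ha (ha.trans (hat.trans htb).le) (hat.trans htb).le) (by linarith)) ⟨hat, htb⟩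

theorem measurableSet_Icc_inter_pos {g : ℝ → ℝ} (hg : ContinuousOn g (Ici 0)) (r : ℝ) :
    MeasurableSet (Icc 0 r ∩ {s | 0 < g s}) := by
  obtain ⟨u, hu, he⟩ := continuousOn_iff'.1 (hg.mono fun s (hs : s ∈ Icc 0 r) => hs.1) (Ioi 0)
    isOpen_Ioi
  have : Icc 0 r ∩ {s | 0 < g s} = u ∩ Icc 0 r := by rw [← he, inter_comm]; rfl
  rw [this]
  exact hu.measurableSet.inter measurableSet_Icc

/-- A server with two classes that works at full rate on the class with positive imbalance: the
time allocated to a class grows at rate `1` where its imbalance is positive. -/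
theorem hasDerivAt_one_of_priority {e₁ e₂ T₁ T₂ : ℝ → ℝ} (he₁ : ContinuousOn e₁ (Ici 0))
    (he₂ : ContinuousOn e₂ (Ici 0)) (hd : ∀ s, 0 ≤ s → ¬ (0 < e₁ s ∧ 0 < e₂ s))
    (hT₁ : MonotoneOn T₁ (Ici 0)) (hT₂ : MonotoneOn T₂ (Ici 0))
    (hc₁ : ContinuousOn T₁ (Ici 0)) (hc₂ : ContinuousOn T₂ (Ici 0))
    (hl₁ : ∀ a b, 0 ≤ a → a ≤ b → T₁ b - T₁ a ≤ b - a)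
    (hl₂ : ∀ a b, 0 ≤ a → a ≤ b → T₂ b - T₂ a ≤ b - a) {F : ℝ → ℝ}
    (hF : ∀ s, F s = (if 0 < e₁ s then e₁ s else 0) + if 0 < e₂ s then e₂ s else 0)
    (h : ∀ r, 0 ≤ r → ∫⁻ s in Icc 0 r, ENNReal.ofReal (F s) =
      (∫⁻ s in Icc 0 r ∩ {s | 0 < e₁ s}, ENNReal.ofReal (F s) ∂(lebesgueStieltjes hT₁)) +
      ∫⁻ s in Icc 0 r ∩ {s | 0 < e₂ s}, ENNReal.ofReal (F s) ∂(lebesgueStieltjes hT₂))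
    {t : ℝ} (ht : 0 < t) :
    (0 < e₁ t → HasDerivAt T₁ 1 t) ∧ (0 < e₂ t → HasDerivAt T₂ 1 t) := by
  obtain ⟨ν₁, hν₁⟩ := exists_lebesgueStieltjes_add_eq_volume hT₁ hc₁ hl₁
  obtain ⟨ν₂, hν₂⟩ := exists_lebesgueStieltjes_add_eq_volume hT₂ hc₂ hl₂
  have hFeq : F = fun s => max (e₁ s) 0 + max (e₂ s) 0 := by
    ext s
    rw [hF]
    congr 1 <;> split_ifs with hs <;> [rw [max_eq_left hs.le]; rw [max_eq_right (not_lt.1 hs)];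
      rw [max_eq_left hs.le]; rw [max_eq_right (not_lt.1 hs)]]
  have hFc : ContinuousOn F (Ici 0) := by
    rw [hFeq]
    exact (he₁.sup continuousOn_const).add (he₂.sup continuousOn_const)
  -- Split Lebesgue measure as `dTᵢ + νᵢ` on the disjoint sets `{eᵢ > 0}`. The priority equation
  -- says that the `dTᵢ` parts already exhaust the finite integral of `F`, so nothing is left for
  -- `νᵢ`.
  have hzero (r : ℝ) (hr : 0 ≤ r) :
      ∫⁻ s in Icc 0 r ∩ {s | 0 < e₁ s}, ENNReal.ofReal (F s) ∂ν₁ = 0 ∧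
      ∫⁻ s in Icc 0 r ∩ {s | 0 < e₂ s}, ENNReal.ofReal (F s) ∂ν₂ = 0 := by
    have hfin : ∫⁻ s in Icc 0 r, ENNReal.ofReal (F s) ≠ ⊤ := by
      have hi : IntegrableOn F (Icc 0 r) :=
        (hFc.mono fun s hs => hs.1).integrableOn_compact isCompact_Icc
      exact hi.lintegral_lt_top.ne
    have hle : (∫⁻ s in Icc 0 r ∩ {s | 0 < e₁ s}, ENNReal.ofReal (F s)) +
        ∫⁻ s in Icc 0 r ∩ {s | 0 < e₂ s}, ENNReal.ofReal (F s) ≤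
          ∫⁻ s in Icc 0 r, ENNReal.ofReal (F s) := by
      rw [← lintegral_union (measurableSet_Icc_inter_pos he₂ r)]
      · exact lintegral_mono_set (union_subset inter_subset_left inter_subset_left)
      · exact disjoint_left.2 fun s hs hs' => hd s hs.1.1 ⟨hs.2, hs'.2⟩
    have hadd (μ ν : Measure ℝ) (S : Set ℝ) : ∫⁻ s in S, ENNReal.ofReal (F s) ∂(μ + ν) =
        (∫⁻ s in S, ENNReal.ofReal (F s) ∂μ) + ∫⁻ s in S, ENNReal.ofReal (F s) ∂ν := by
      rw [Measure.restrict_add, lintegral_add_measure]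
    have h₁ := hadd (lebesgueStieltjes hT₁) ν₁ (Icc 0 r ∩ {s | 0 < e₁ s})
    have h₂ := hadd (lebesgueStieltjes hT₂) ν₂ (Icc 0 r ∩ {s | 0 < e₂ s})
    rw [hν₁] at h₁
    rw [hν₂] at h₂
    rw [h₁, h₂, add_add_add_comm, ← h r hr] at hle
    have := (ENNReal.cancel_of_ne hfin).add_le_iff_nonpos_right.1 hle
    simpa using this
  have main {e T : ℝ → ℝ} {ν : Measure ℝ} (he : ContinuousOn e (Ici 0))
      (hT : MonotoneOn T (Ici 0)) (hc : ContinuousOn T (Ici 0))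
      (hl : ∀ a b, 0 ≤ a → a ≤ b → T b - T a ≤ b - a) (hν : lebesgueStieltjes hT + ν = volume)
      (hz : ∀ r, 0 ≤ r → ∫⁻ s in Icc 0 r ∩ {s | 0 < e s}, ENNReal.ofReal (F s) ∂ν = 0)
      (hFe : ∀ s, e s ≤ F s) (het : 0 < e t) : HasDerivAt T 1 t := by
    obtain ⟨a, b, ha, hat, htb, hab⟩ := exists_Icc_half_le he ht het
    have hle := (hat.trans htb).le
    have h0 := measure_Icc_eq_zero_of_setLIntegral (hz b (ha.trans hle))
      (fun s hs => ⟨⟨ha.trans hs.1, hs.2⟩, (half_pos het).trans_le (hab s hs)⟩) (half_pos het)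
      (fun s hs => ENNReal.ofReal_le_ofReal ((hab s hs).trans (hFe s)))
    have h1 := congrArg (fun μ : Measure ℝ => μ (Ioc a b)) hν
    simp only [Measure.add_apply, measure_mono_null Ioc_subset_Icc_self h0, add_zero,
      lebesgueStieltjes_Ioc hT hc ha hle, Real.volume_Ioc] at h1
    have h2 : T b - T a = b - a :=
      (ENNReal.ofReal_eq_ofReal_iff (sub_nonneg.2 (hT ha (ha.trans hle) hle))
        (sub_nonneg.2 hle)).1 h1
    -- The unused time `s - T s` is monotone with equal endpoint values, hence constant on the
    -- interval.
    have hm : MonotoneOn (fun s => s - T s) (Icc a b) := fun r hr s _ hrs => by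
      linarith [hl r s (ha.trans hr.1) hrs]
    have := (hasDerivAt_id t).sub
      (hasDerivAt_zero_of_monotoneOn hm (show a - T a = b - T b by linarith) ⟨hat, htb⟩)
    rw [sub_zero] at this
    exact this.congr_of_eventuallyEq (.of_forall fun s => by simp)
  refine ⟨main he₁ hT₁ hc₁ hl₁ hν₁ (fun r hr => (hzero r hr).1) fun s => ?_,
    main he₂ hT₂ hc₂ hl₂ hν₂ (fun r hr => (hzero r hr).2) fun s => ?_⟩ <;> rw [hFeq]
  · linarith [le_max_left (e₁ s) 0, le_max_right (e₂ s) 0]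
  · linarith [le_max_left (e₂ s) 0, le_max_right (e₁ s) 0]

/-! ### Closure properties of Lipschitz functions -/

/-- Lipschitz continuity on `[0, ∞)`, with some constant. -/
def LipschitzOnNonneg (f : ℝ → ℝ) : Prop := ∃ K, LipschitzOnWith K f (Ici 0)

namespace LipschitzOnNonneg

variable {f g : ℝ → ℝ}

theorem comp {φ : ℝ → ℝ} {K : NNReal} (hφ : LipschitzWith K φ) (hf : LipschitzOnNonneg f) :
    LipschitzOnNonneg fun t => φ (f t) :=
  let ⟨_, h⟩ := hf
  ⟨_, hφ.comp_lipschitzOnWith h⟩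

theorem const_mul (c : ℝ) (hf : LipschitzOnNonneg f) : LipschitzOnNonneg fun t => c * f t :=
  comp (lipschitzWith_smul c) hf

theorem add (hf : LipschitzOnNonneg f) (hg : LipschitzOnNonneg g) :
    LipschitzOnNonneg fun t => f t + g t :=
  let ⟨_, h⟩ := hf
  let ⟨_, h'⟩ := hg
  ⟨_, h.add h'⟩

theorem neg (hf : LipschitzOnNonneg f) : LipschitzOnNonneg fun t => -f t :=
  let ⟨_, h⟩ := hf
  ⟨_, h.neg⟩

theorem sub (hf : LipschitzOnNonneg f) (hg : LipschitzOnNonneg g) :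
    LipschitzOnNonneg fun t => f t - g t :=
  let ⟨_, h⟩ := hf
  let ⟨_, h'⟩ := hg
  ⟨_, h.sub h'⟩

theorem max_zero (hf : LipschitzOnNonneg f) : LipschitzOnNonneg fun t => max (f t) 0 :=
  comp (LipschitzWith.id.max_const 0) hf

theorem congr (hf : LipschitzOnNonneg f) (h : ∀ t, 0 ≤ t → g t = f t) : LipschitzOnNonneg g :=
  let ⟨K, hK⟩ := hf
  ⟨K, fun a ha b hb => by rw [h a ha, h b hb]; exact hK ha hb⟩

theorem continuousOn (hf : LipschitzOnNonneg f) : ContinuousOn f (Ici 0) :=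
  let ⟨_, h⟩ := hf
  h.continuousOn

theorem ae_differentiableAt (hf : LipschitzOnNonneg f) :
    ∀ᵐ t, 0 < t → DifferentiableAt ℝ f t :=
  let ⟨_, h⟩ := hf
  h.ae_differentiableAt_of_pos

theorem of_monotoneOn (hf : MonotoneOn f (Ici 0))
    (h : ∀ a b, 0 ≤ a → a ≤ b → f b - f a ≤ b - a) : LipschitzOnNonneg f := by
  refine ⟨1, LipschitzOnWith.of_dist_le_mul fun a ha b hb => ?_⟩
  rw [NNReal.coe_one, one_mul, Real.dist_eq, Real.dist_eq]
  rcases le_total a b with hab | hab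
  · rw [abs_sub_comm, abs_sub_comm a, abs_of_nonneg (sub_nonneg.2 (hf ha hb hab)),
      abs_of_nonneg (sub_nonneg.2 hab)]
    exact h a b ha hab
  · rw [abs_of_nonneg (sub_nonneg.2 (hf hb ha hab)), abs_of_nonneg (sub_nonneg.2 hab)]
    exact h b a hb hab

theorem const (c : ℝ) : LipschitzOnNonneg fun _ => c := ⟨0, LipschitzWith.const c |>.lipschitzOnWith⟩

theorem stationLyapunov (A B p : ℝ) (hf : LipschitzOnNonneg f) :
    LipschitzOnNonneg fun t => stationLyapunov A B p (f t) :=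
  (hf.max_zero.const_mul _).add (hf.neg.max_zero.const_mul _)

end LipschitzOnNonneg

/-! ### The DHV network in coordinates -/

theorem MulticlassNetwork.IsRatioMatrix.mulVec_apply {J K : ℕ} {N : MulticlassNetwork J K}
    {Δ : Matrix (Fin K) (Fin J) ℝ} (hΔ : N.IsRatioMatrix Δ) (w : Fin J → ℝ) (k : Fin K) :
    (Δ *ᵥ w) k = Δ k (N.station k) * w (N.station k) := by
  rw [Matrix.mulVec, dotProduct]
  exact Finset.sum_eq_single _ (fun j _ hj => by rw [hΔ.support k j hj.symm, zero_mul])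
    fun h => absurd (Finset.mem_univ _) h

/-- The class at the first visit to a station of the DHV network. -/
def dhvLow : Fin 3 → Fin 6 := ![0, 1, 2]

/-- The class at the second visit to a station of the DHV network. -/
def dhvHigh : Fin 3 → Fin 6 := ![3, 4, 5]

theorem eq_dhvLow_or_eq_dhvHigh : ∀ k, ∃ j, k = dhvLow j ∨ k = dhvHigh j := by decide

section DHV

variable {m : Fin 6 → ℝ} {hm : ∀ k, 0 < m k} {α₁ : ℝ} {hα₁ : 0 ≤ α₁}

theorem dhv_station_low (j : Fin 3) : (dhvNetwork m hm α₁ hα₁).station (dhvLow j) = j := by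
  fin_cases j <;> rfl

theorem dhv_station_high (j : Fin 3) : (dhvNetwork m hm α₁ hα₁).station (dhvHigh j) = j := by
  fin_cases j <;> rfl

theorem dhv_C_apply (j : Fin 3) (k : Fin 6) : (dhvNetwork m hm α₁ hα₁).C j k =
    if (![0, 1, 2, 0, 1, 2] : Fin 6 → Fin 3) k = j then 1 else 0 := rfl

theorem dhv_CM_mulVec (z : Fin 6 → ℝ) (j : Fin 3) :
    (((dhvNetwork m hm α₁ hα₁).C * (dhvNetwork m hm α₁ hα₁).M) *ᵥ z) j =
      m (dhvLow j) * z (dhvLow j) + m (dhvHigh j) * z (dhvHigh j) := by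
  have h (k : Fin 6) : ((dhvNetwork m hm α₁ hα₁).C * (dhvNetwork m hm α₁ hα₁).M) j k =
      (dhvNetwork m hm α₁ hα₁).C j k * m k := Matrix.mul_diagonal _ _ _ _
  simp only [Matrix.mulVec, dotProduct, Fin.sum_univ_six, h, dhv_C_apply]
  fin_cases j <;> simp [dhvLow, dhvHigh]

theorem dhv_workload (Z : ℝ → Fin 6 → ℝ) (t : ℝ) (j : Fin 3) :
    (dhvNetwork m hm α₁ hα₁).workload Z t j =
      m (dhvLow j) * Z t (dhvLow j) + m (dhvHigh j) * Z t (dhvHigh j) :=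
  dhv_CM_mulVec _ _

theorem dhv_idleTime (T : ℝ → Fin 6 → ℝ) (t : ℝ) (j : Fin 3) :
    (dhvNetwork m hm α₁ hα₁).idleTime T t j = t - (T t (dhvLow j) + T t (dhvHigh j)) := by
  simp only [MulticlassNetwork.idleTime, Pi.sub_apply, Matrix.mulVec, dotProduct,
    Fin.sum_univ_six, dhv_C_apply]
  fin_cases j <;> simp [dhvLow, dhvHigh]

theorem dhv_classes (j : Fin 3) :
    (Finset.univ.filter fun i => i ≤ dhvHigh j ∧ (dhvNetwork m hm α₁ hα₁).station i =
      (dhvNetwork m hm α₁ hα₁).station (dhvHigh j)) = {dhvLow j, dhvHigh j} := by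
  have : ∀ (j : Fin 3) (i : Fin 6), (i ≤ dhvHigh j ∧ (![0, 1, 2, 0, 1, 2] : Fin 6 → Fin 3) i =
      (![0, 1, 2, 0, 1, 2] : Fin 6 → Fin 3) (dhvHigh j)) ↔ (i = dhvLow j ∨ i = dhvHigh j) := by
    decide
  ext i
  rw [Finset.mem_filter, Finset.mem_insert, Finset.mem_singleton]
  exact (and_iff_right (Finset.mem_univ i)).trans (this j i)

theorem dhvLow_ne_dhvHigh (j : Fin 3) : dhvLow j ≠ dhvHigh j := by
  revert j
  decide

/-- Every class has effective rate `α₁`: the constant vector solves the traffic equations, and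
nilpotent routing makes the solution unique. This extracts `α₁ < 1` from the nominal load. -/
theorem dhv_trafficIntensity_zero (hbal : m 0 + m 3 = 1) :
    (dhvNetwork m hm α₁ hα₁).trafficIntensity 0 = α₁ := by
  have hmul : (1 - (dhvNetwork m hm α₁ hα₁).Pᵀ) *ᵥ (fun _ => α₁) = (dhvNetwork m hm α₁ hα₁).α := by
    show (1 - dhvRoutingᵀ) *ᵥ (fun _ => α₁) = Pi.single 0 α₁
    ext k
    simp only [Matrix.mulVec, dotProduct, Fin.sum_univ_six, Matrix.sub_apply,
      Matrix.transpose_apply, Matrix.one_apply, dhvRouting, Matrix.of_apply]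
    fin_cases k <;> simp
  have hunit : IsUnit (1 - (dhvNetwork m hm α₁ hα₁).Pᵀ) := by
    refine IsNilpotent.isUnit_one_sub ⟨6, ?_⟩
    rw [← Matrix.transpose_pow]
    show (dhvRouting ^ 6)ᵀ = 0
    rw [dhvRouting_pow_six, Matrix.transpose_zero]
  have hrate : (dhvNetwork m hm α₁ hα₁).effectiveRate = fun _ => α₁ := by
    rw [MulticlassNetwork.effectiveRate, MulticlassNetwork.Q, ← hmul, Matrix.mulVec_mulVec,
      Matrix.nonsing_inv_mul _ ((Matrix.isUnit_iff_isUnit_det _).1 hunit), Matrix.one_mulVec]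
  rw [MulticlassNetwork.trafficIntensity, hrate, dhv_CM_mulVec, ← add_mul]
  show (m 0 + m 3) * α₁ = α₁
  rw [hbal, one_mul]

variable {Δ : Matrix (Fin 6) (Fin 3) ℝ}

theorem dhv_proportions (hΔ : (dhvNetwork m hm α₁ hα₁).IsRatioMatrix Δ) (j : Fin 3) :
    m (dhvLow j) * Δ (dhvLow j) j + m (dhvHigh j) * Δ (dhvHigh j) j = 1 := by
  have := congrFun (congrFun hΔ.proportions j) j
  rw [Matrix.one_apply_eq] at this
  rw [← this]
  exact (dhv_CM_mulVec (fun k => Δ k j) j).symm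

/-- The proportion of the workload of a station that the policy keeps in the first class. -/
def dhvProportion (m : Fin 6 → ℝ) (Δ : Matrix (Fin 6) (Fin 3) ℝ) (j : Fin 3) : ℝ :=
  m (dhvLow j) * Δ (dhvLow j) j

theorem dhvProportion_nonneg (hΔ : (dhvNetwork m hm α₁ hα₁).IsRatioMatrix Δ) (j : Fin 3) :
    0 ≤ dhvProportion m Δ j :=
  mul_nonneg (hm _).le (hΔ.nonneg _ _)

theorem dhvProportion_le_one (hΔ : (dhvNetwork m hm α₁ hα₁).IsRatioMatrix Δ) (j : Fin 3) :
    dhvProportion m Δ j ≤ 1 := by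
  have := mul_nonneg (hm (dhvHigh j)).le (hΔ.nonneg (dhvHigh j) j)
  have := dhv_proportions hΔ j
  unfold dhvProportion
  linarith

/-- The work by which the first class of a station exceeds its proportion. -/
def dhvExcess (m : Fin 6 → ℝ) (Δ : Matrix (Fin 6) (Fin 3) ℝ) (Z : ℝ → Fin 6 → ℝ) (j : Fin 3)
    (t : ℝ) : ℝ :=
  (1 - dhvProportion m Δ j) * (m (dhvLow j) * Z t (dhvLow j)) -
    dhvProportion m Δ j * (m (dhvHigh j) * Z t (dhvHigh j))

theorem dhv_imbalance_low (hΔ : (dhvNetwork m hm α₁ hα₁).IsRatioMatrix Δ) (Z : ℝ → Fin 6 → ℝ)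
    (j : Fin 3) (t : ℝ) : m (dhvLow j) * (dhvNetwork m hm α₁ hα₁).imbalance Δ Z t (dhvLow j) =
      dhvExcess m Δ Z j t := by
  rw [MulticlassNetwork.imbalance, Pi.sub_apply, hΔ.mulVec_apply, dhv_station_low, dhv_workload,
    dhvExcess, dhvProportion]
  ring

/-- The two work imbalances of a station cancel because the proportions add to 1. So one scalar per
station suffices, and its classes never have positive imbalance together. -/
theorem dhv_imbalance_high (hΔ : (dhvNetwork m hm α₁ hα₁).IsRatioMatrix Δ) (Z : ℝ → Fin 6 → ℝ)
    (j : Fin 3) (t : ℝ) : m (dhvHigh j) * (dhvNetwork m hm α₁ hα₁).imbalance Δ Z t (dhvHigh j) =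
      -dhvExcess m Δ Z j t := by
  rw [MulticlassNetwork.imbalance, Pi.sub_apply, hΔ.mulVec_apply, dhv_station_high, dhv_workload,
    dhvExcess, dhvProportion]
  linear_combination -(m (dhvLow j) * Z t (dhvLow j) + m (dhvHigh j) * Z t (dhvHigh j)) *
    dhv_proportions hΔ j

end DHV

/-! ### Fluid solutions of the DHV network -/

section DHV

variable {m : Fin 6 → ℝ} {hm : ∀ k, 0 < m k} {α₁ : ℝ} {hα₁ : 0 ≤ α₁}
  {Δ : Matrix (Fin 6) (Fin 3) ℝ} {Z T : ℝ → Fin 6 → ℝ}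

theorem dhv_T_sub_le (sol : (dhvNetwork m hm α₁ hα₁).IsFluidSolution Δ Z T) (k : Fin 6) (a b : ℝ)
    (ha : 0 ≤ a) (hab : a ≤ b) : T b k - T a k ≤ b - a := by
  obtain ⟨j, hj⟩ := eq_dhvLow_or_eq_dhvHigh k
  have hY := sol.Y_mono j ha (ha.trans hab) hab
  simp only [dhv_idleTime] at hY
  have h₁ : T a (dhvLow j) ≤ T b (dhvLow j) := sol.T_mono _ ha (ha.trans hab) hab
  have h₂ : T a (dhvHigh j) ≤ T b (dhvHigh j) := sol.T_mono _ ha (ha.trans hab) hab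
  rcases hj with rfl | rfl <;> linarith

theorem dhv_lipschitz_T (sol : (dhvNetwork m hm α₁ hα₁).IsFluidSolution Δ Z T) (k : Fin 6) :
    LipschitzOnNonneg fun t => T t k :=
  .of_monotoneOn (sol.T_mono k) (dhv_T_sub_le sol k)

/-- The rates at which jobs arrive at the classes when the departure rates are `d`. -/
def dhvArrivalRate (α₁ : ℝ) (d : Fin 6 → ℝ) : Fin 6 → ℝ := ![α₁, d 0, d 1, d 2, d 3, d 4]

theorem dhv_flow (sol : (dhvNetwork m hm α₁ hα₁).IsFluidSolution Δ Z T) {t : ℝ} (ht : 0 ≤ t)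
    (k : Fin 6) : Z t k =
      Z 0 k + dhvArrivalRate (t * α₁) (fun i => T t i / m i) k - T t k / m k := by
  have h := congrFun (sol.balance t ht) k
  have hmul (i : Fin 6) : ((1 - (dhvNetwork m hm α₁ hα₁).Pᵀ) * (dhvNetwork m hm α₁ hα₁).Minv) k i =
      (1 - dhvRoutingᵀ) k i * (1 / m i) := Matrix.mul_diagonal _ _ _ _
  have hα : (dhvNetwork m hm α₁ hα₁).α = Pi.single 0 α₁ := rfl
  rw [h, hα]
  simp only [Pi.sub_apply, Pi.add_apply, Pi.smul_apply, Matrix.mulVec, dotProduct,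
    Fin.sum_univ_six, hmul, Matrix.sub_apply, Matrix.transpose_apply, Matrix.one_apply,
    dhvRouting, Matrix.of_apply, smul_eq_mul]
  fin_cases k <;> simp [dhvArrivalRate] <;> ring

theorem hasDerivAt_dhvArrivalRate {d : ℝ → Fin 6 → ℝ} {d' : Fin 6 → ℝ} {t : ℝ}
    (h : ∀ k, HasDerivAt (fun s => d s k) (d' k) t) (k : Fin 6) :
    HasDerivAt (fun s => dhvArrivalRate (s * α₁) (d s) k) (dhvArrivalRate α₁ d' k) t := by
  fin_cases k
  · exact hasDerivAt_mul_const α₁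
  all_goals exact h _

theorem dhv_lipschitz_Z (sol : (dhvNetwork m hm α₁ hα₁).IsFluidSolution Δ Z T) (k : Fin 6) :
    LipschitzOnNonneg fun t => Z t k := by
  have hd (i : Fin 6) : LipschitzOnNonneg fun t => T t i / m i :=
    ((dhv_lipschitz_T sol i).const_mul (m i)⁻¹).congr fun t _ => by ring
  have hid : LipschitzOnNonneg fun t => t * α₁ :=
    (LipschitzOnNonneg.const_mul α₁ ⟨1, LipschitzWith.id.lipschitzOnWith⟩).congr fun t _ => by
      simp [mul_comm]
  have harr : LipschitzOnNonneg fun t => dhvArrivalRate (t * α₁) (fun i => T t i / m i) k := by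
    fin_cases k
    · exact hid
    all_goals exact hd _
  exact (((LipschitzOnNonneg.const (Z 0 k)).add harr).sub (hd k)).congr fun t ht => dhv_flow sol ht k

theorem dhv_lipschitz_excess (sol : (dhvNetwork m hm α₁ hα₁).IsFluidSolution Δ Z T) (j : Fin 3) :
    LipschitzOnNonneg (dhvExcess m Δ Z j) :=
  (((dhv_lipschitz_Z sol _).const_mul _).const_mul _).sub
    (((dhv_lipschitz_Z sol _).const_mul _).const_mul _)

theorem dhv_nonidling (sol : (dhvNetwork m hm α₁ hα₁).IsFluidSolution Δ Z T) (j : Fin 3)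
    {t τ₁ τ₂ : ℝ} (ht : 0 < t) (h₁ : HasDerivAt (fun s => T s (dhvLow j)) τ₁ t)
    (h₂ : HasDerivAt (fun s => T s (dhvHigh j)) τ₂ t)
    (hW : 0 < m (dhvLow j) * Z t (dhvLow j) + m (dhvHigh j) * Z t (dhvHigh j)) :
    τ₁ + τ₂ = 1 := by
  have hY : (fun s => (dhvNetwork m hm α₁ hα₁).idleTime T s j) =
      fun s => s - (T s (dhvLow j) + T s (dhvHigh j)) := funext fun s => dhv_idleTime T s j
  have hYc : ContinuousOn (fun s => (dhvNetwork m hm α₁ hα₁).idleTime T s j) (Ici 0) := by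
    rw [hY]
    exact continuousOn_id.sub
      ((dhv_lipschitz_T sol _).continuousOn.add (dhv_lipschitz_T sol _).continuousOn)
  have hWc : ContinuousOn (fun s => (dhvNetwork m hm α₁ hα₁).workload Z s j) (Ici 0) := by
    simp only [dhv_workload]
    exact (((dhv_lipschitz_Z sol _).const_mul _).add
      ((dhv_lipschitz_Z sol _).const_mul _)).continuousOn
  have h := hasDerivAt_zero_of_lintegral_eq_zero (sol.Y_mono j) hYc hWc (sol.nonidling j) ht
    (by rwa [dhv_workload])
  rw [hY] at h
  linarith [h.unique ((hasDerivAt_id t).sub (h₁.add h₂))]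

theorem dhv_priority (sol : (dhvNetwork m hm α₁ hα₁).IsFluidSolution Δ Z T)
    (hΔ : (dhvNetwork m hm α₁ hα₁).IsRatioMatrix Δ) (j : Fin 3) {t : ℝ} (ht : 0 < t) :
    (0 < dhvExcess m Δ Z j t → HasDerivAt (fun s => T s (dhvLow j)) 1 t) ∧
      (dhvExcess m Δ Z j t < 0 → HasDerivAt (fun s => T s (dhvHigh j)) 1 t) := by
  have hl (s : ℝ) : (dhvNetwork m hm α₁ hα₁).imbalance Δ Z s (dhvLow j) =
      (m (dhvLow j))⁻¹ * dhvExcess m Δ Z j s := by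
    rw [← dhv_imbalance_low hΔ, inv_mul_cancel_left₀ (hm _).ne']
  have hh (s : ℝ) : (dhvNetwork m hm α₁ hα₁).imbalance Δ Z s (dhvHigh j) =
      (m (dhvHigh j))⁻¹ * -dhvExcess m Δ Z j s := by
    rw [← dhv_imbalance_high hΔ, inv_mul_cancel_left₀ (hm _).ne']
  have il := inv_pos.2 (hm (dhvLow j))
  have ih := inv_pos.2 (hm (dhvHigh j))
  have hx := dhv_lipschitz_excess sol j
  have := hasDerivAt_one_of_priority
    (e₁ := fun s => (dhvNetwork m hm α₁ hα₁).imbalance Δ Z s (dhvLow j))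
    (e₂ := fun s => (dhvNetwork m hm α₁ hα₁).imbalance Δ Z s (dhvHigh j))
    (by simp only [hl]; exact (hx.const_mul _).continuousOn)
    (by simp only [hh]; exact (hx.neg.const_mul _).continuousOn)
    (fun s _ => by
      rw [hl, hh, mul_pos_iff_of_pos_left il, mul_pos_iff_of_pos_left ih]
      rintro ⟨h₁, h₂⟩
      linarith)
    (sol.T_mono _) (sol.T_mono _) (dhv_lipschitz_T sol _).continuousOn
    (dhv_lipschitz_T sol _).continuousOn (dhv_T_sub_le sol _) (dhv_T_sub_le sol _)
    -- The priority equation of the higher class is enough: its sums run over both classes of the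
    -- station.
    (F := fun s => (dhvNetwork m hm α₁ hα₁).imbalancePlus Δ Z (dhvHigh j) s)
    (fun s => by
      rw [MulticlassNetwork.imbalancePlus, dhv_classes, Finset.sum_pair (dhvLow_ne_dhvHigh j)])
    (fun r hr => by
      rw [sol.priority (dhvHigh j) r hr, dhv_classes, Finset.sum_pair (dhvLow_ne_dhvHigh j)])
    ht
  simpa only [hl, hh, mul_pos_iff_of_pos_left il, mul_pos_iff_of_pos_left ih, neg_pos] using this

theorem dhv_stationRates (sol : (dhvNetwork m hm α₁ hα₁).IsFluidSolution Δ Z T)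
    (hΔ : (dhvNetwork m hm α₁ hα₁).IsRatioMatrix Δ) {A B : ℝ} (hA : 0 ≤ A) (hB : 0 ≤ B) (j : Fin 3)
    {t : ℝ} (ht : 0 < t) {τ : Fin 6 → ℝ} (hT : ∀ k, HasDerivAt (fun s => T s k) (τ k) t)
    (d₁ : DifferentiableAt ℝ (fun s => max (dhvExcess m Δ Z j s) 0) t)
    (d₂ : DifferentiableAt ℝ (fun s => max (-dhvExcess m Δ Z j s) 0) t) :
    StationRates (m (dhvLow j)) (m (dhvHigh j)) (dhvProportion m Δ j) (dhvExcess m Δ Z j t)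
      (dhvArrivalRate α₁ (fun i => τ i / m i) (dhvLow j))
      (dhvArrivalRate α₁ (fun i => τ i / m i) (dhvHigh j))
      (τ (dhvLow j) / m (dhvLow j)) (τ (dhvHigh j) / m (dhvHigh j)) ∧
    ∃ L', HasDerivAt
        (fun s => stationLyapunov A B (dhvProportion m Δ j) (dhvExcess m Δ Z j s)) L' t ∧
      L' ≤ stationDrift A B (m (dhvLow j)) (m (dhvHigh j)) (dhvExcess m Δ Z j t)
        (dhvArrivalRate α₁ (fun i => τ i / m i) (dhvLow j))
        (dhvArrivalRate α₁ (fun i => τ i / m i) (dhvHigh j)) := by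
  have hτ (k : Fin 6) : 0 ≤ τ k := (hT k).nonneg_of_monotoneOn_Ici (sol.T_mono k) ht
  have harr (k : Fin 6) : 0 ≤ dhvArrivalRate α₁ (fun i => τ i / m i) k := by
    fin_cases k
    · exact hα₁
    all_goals exact div_nonneg (hτ _) (hm _).le
  have hZ (k : Fin 6) : HasDerivAt (fun s => Z s k)
      (dhvArrivalRate α₁ (fun i => τ i / m i) k - τ k / m k) t := by
    have hd (k : Fin 6) : HasDerivAt (fun s => T s k / m k) (τ k / m k) t := (hT k).div_const _
    refine (((hasDerivAt_dhvArrivalRate (α₁ := α₁) hd k).const_add (Z 0 k)).sub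
      (hd k)).congr_of_eventuallyEq ?_
    filter_upwards [lt_mem_nhds ht] with s hs
    exact dhv_flow sol hs.le k
  have nn (k : Fin 6) : ∀ᶠ s in nhds t, 0 ≤ Z s k := by
    filter_upwards [lt_mem_nhds ht] with s hs using sol.Z_nonneg s hs.le k
  have hidle : 0 ≤ 1 - (τ (dhvLow j) + τ (dhvHigh j)) := by
    refine HasDerivAt.nonneg_of_monotoneOn_Ici ((hasDerivAt_id t).sub ((hT _).add (hT _))) ?_ ht
    have := sol.Y_mono j
    simp only [dhv_idleTime] at this
    exact this
  have hprio := dhv_priority sol hΔ j ht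
  exact stationRates_of_hasDerivAt hA hB (hm _) (hm _) (dhvProportion_nonneg hΔ j)
    (dhvProportion_le_one hΔ j) (harr _) (harr _) (funext fun s => rfl) (hZ _) (hZ _) (nn _) (nn _)
    (hτ _) (hτ _) (by linarith) (dhv_nonidling sol j ht (hT _) (hT _))
    (fun h => (hT _).unique (hprio.1 h)) (fun h => (hT _).unique (hprio.2 h)) d₁ d₂

/-- State-space collapse for a fluid solution whose excesses vanish. -/
theorem dhv_eq_of_excess_eq_zero (hΔ : (dhvNetwork m hm α₁ hα₁).IsRatioMatrix Δ) {t : ℝ}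
    (h : ∀ j, dhvExcess m Δ Z j t = 0) :
    Z t = Δ *ᵥ (dhvNetwork m hm α₁ hα₁).workload Z t := by
  rw [← sub_eq_zero]
  ext k
  obtain ⟨j, rfl | rfl⟩ := eq_dhvLow_or_eq_dhvHigh k
  · exact (mul_eq_zero_iff_left (hm _).ne').1 ((dhv_imbalance_low hΔ Z j t).trans (h j))
  · exact (mul_eq_zero_iff_left (hm _).ne').1 ((dhv_imbalance_high hΔ Z j t).trans (by simp [h j]))

theorem dhvExcess_eq_zero_of_lyapunov (sol : (dhvNetwork m hm α₁ hα₁).IsFluidSolution Δ Z T)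
    (hΔ : (dhvNetwork m hm α₁ hα₁).IsRatioMatrix Δ) {A B : ℝ} (hA : 0 < A) (hB : 0 < B) (j : Fin 3)
    {t : ℝ} (ht : 0 ≤ t)
    (h : stationLyapunov A B (dhvProportion m Δ j) (dhvExcess m Δ Z j t) = 0) :
    dhvExcess m Δ Z j t = 0 := by
  have h₁ := mul_nonneg (hm (dhvLow j)).le (sol.Z_nonneg t ht (dhvLow j))
  have h₂ := mul_nonneg (hm (dhvHigh j)).le (sol.Z_nonneg t ht (dhvHigh j))
  refine eq_zero_of_stationLyapunov_eq_zero hA hB (dhvProportion_nonneg hΔ j)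
    (dhvProportion_le_one hΔ j) (fun hp => ?_) (fun hp => ?_) h <;> rw [dhvExcess, hp] <;> linarith

end DHV

/-! ### State-space collapse -/

theorem mainTheorem8 (m : Fin 6 → ℝ) (hm : ∀ k, 0 < m k)
    (hbal₁ : m 0 + m 3 = 1) (hbal₂ : m 1 + m 4 = 1) (hbal₃ : m 2 + m 5 = 1) :
    ∃ αbar : ℝ, 0 < αbar ∧ αbar < 1 ∧
      ∀ (α₁ : ℝ) (hα₁ : 0 ≤ α₁), αbar < α₁ →
        (dhvNetwork m hm α₁ hα₁).NominalLoad →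
        m 1 + m 3 + m 5 < 2 →
        ∀ Δ : Matrix (Fin 6) (Fin 3) ℝ, (dhvNetwork m hm α₁ hα₁).IsRatioMatrix Δ →
          (dhvNetwork m hm α₁ hα₁).StateSpaceCollapse Δ := by
  have pos := hm
  -- Indices count from 0. This `y` satisfies `m 4 * y ≤ m 1 / 2` and `m 5 * y ≤ m 2 / 2`; the
  -- threshold `1 - m 3 * m 4 * y` then gives the two lower bounds on `y` that the drift estimate
  -- requires.
  obtain ⟨y, hy⟩ : ∃ y, y = m 1 * m 2 / 2 := ⟨_, rfl⟩
  have hy0 : 0 < y := by rw [hy]; exact half_pos (mul_pos (hm 1) (hm 2))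
  have hy1 : y < 1 := by nlinarith [pos 1, pos 2, pos 4, pos 5]
  have h34 := mul_pos (pos 3) (pos 4)
  have h34' : m 3 * m 4 ≤ m 3 := mul_le_of_le_one_right (pos 3).le (by linarith [pos 1])
  have h34'' : m 3 * m 4 ≤ m 4 := mul_le_of_le_one_left (pos 4).le (by linarith [pos 0])
  have hc : m 3 * m 4 * y < 1 := by nlinarith [pos 0]
  refine ⟨1 - m 3 * m 4 * y, by linarith, by linarith [mul_pos h34 hy0], ?_⟩
  intro α₁ hα₁ hα hload h246 Δ hΔ z₀
  have hα' : α₁ < 1 := by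
    have := hload 0
    rwa [dhv_trafficIntensity_zero hbal₁] at this
  obtain ⟨A₁, A₂, A₃, B₁, B₂, B₃, w⟩ := exists_lyapunovWeights (pos 0) (pos 1) (pos 2) (pos 3)
    (pos 4) (pos 5) hbal₁ hbal₂ hbal₃ h246
  have hA₁ := w.A₁_pos
  have hA₂ : 0 < A₂ := pos_of_mul_pos_left (zero_lt_one.trans_le w.A₂_ge) (pos 4).le
  have hA₃ : 0 < A₃ := pos_of_mul_pos_left (zero_lt_one.trans_le w.A₃_ge) (pos 5).le
  have hB₁ : 0 < B₁ := pos_of_mul_pos_left (zero_lt_one.trans_le w.B₁_ge) (pos 0).le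
  have hB₂ : 0 < B₂ := pos_of_mul_pos_left (zero_lt_one.trans_le w.B₂_ge) (half_pos (pos 1)).le
  have hB₃ : 0 < B₃ := pos_of_mul_pos_left (zero_lt_one.trans_le w.B₃_ge) (half_pos (pos 2)).le
  let L (Z : ℝ → Fin 6 → ℝ) (t : ℝ) : ℝ :=
    stationLyapunov A₁ B₁ (dhvProportion m Δ 0) (dhvExcess m Δ Z 0 t) +
    stationLyapunov A₂ B₂ (dhvProportion m Δ 1) (dhvExcess m Δ Z 1 t) +
    stationLyapunov A₃ B₃ (dhvProportion m Δ 2) (dhvExcess m Δ Z 2 t)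
  have hp := dhvProportion_nonneg hΔ
  have hp' := dhvProportion_le_one hΔ
  have nn₁ x := stationLyapunov_nonneg (x := x) hA₁.le hB₁.le (hp 0) (hp' 0)
  have nn₂ x := stationLyapunov_nonneg (x := x) hA₂.le hB₂.le (hp 1) (hp' 1)
  have nn₃ x := stationLyapunov_nonneg (x := x) hA₃.le hB₃.le (hp 2) (hp' 2)
  have hL (Z : ℝ → Fin 6 → ℝ) (t : ℝ) : 0 ≤ L Z t := add_nonneg (add_nonneg (nn₁ _) (nn₂ _)) (nn₃ _)
  -- At drift `-1` the initial value of `L` is itself the collapse time; evaluating it on the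
  -- constant path shows that it depends on `z₀` only.
  refine ⟨L (fun _ => z₀) 0, hL _ _, fun Z T sol hZ0 t ht => ?_⟩
  have hLz : L Z 0 = L (fun _ => z₀) 0 := by simp only [L, dhvExcess, hZ0]
  rw [← hLz] at ht
  have hx := dhv_lipschitz_excess sol
  obtain ⟨K, hK⟩ : LipschitzOnNonneg (L Z) :=
    (((hx 0).stationLyapunov _ _ _).add ((hx 1).stationLyapunov _ _ _)).add
      ((hx 2).stationLyapunov _ _ _)
  have hdT : ∀ᵐ s, ∀ k, 0 < s → DifferentiableAt ℝ (fun s => T s k) s :=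
    ae_all_iff.2 fun k => (dhv_lipschitz_T sol k).ae_differentiableAt
  have hdp : ∀ᵐ s, ∀ j, 0 < s → DifferentiableAt ℝ (fun s => max (dhvExcess m Δ Z j s) 0) s :=
    ae_all_iff.2 fun j => (hx j).max_zero.ae_differentiableAt
  have hdn : ∀ᵐ s, ∀ j, 0 < s → DifferentiableAt ℝ (fun s => max (-dhvExcess m Δ Z j s) 0) s :=
    ae_all_iff.2 fun j => (hx j).neg.max_zero.ae_differentiableAt
  have hzero : L Z t = 0 := by
    refine eq_zero_of_ae_deriv_le_neg_one hK (fun _ _ => hL _ _) ?_ ht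
    filter_upwards [hdT, hdp, hdn] with s h₁ h₂ h₃ hs L' hL' hpos
    have hT k := (h₁ k hs).hasDerivAt
    obtain ⟨r₁, l₁, D₁, b₁⟩ := dhv_stationRates sol hΔ hA₁.le hB₁.le 0 hs hT (h₂ 0 hs) (h₃ 0 hs)
    obtain ⟨r₂, l₂, D₂, b₂⟩ := dhv_stationRates sol hΔ hA₂.le hB₂.le 1 hs hT (h₂ 1 hs) (h₃ 1 hs)
    obtain ⟨r₃, l₃, D₃, b₃⟩ := dhv_stationRates sol hΔ hA₃.le hB₃.le 2 hs hT (h₂ 2 hs) (h₃ 2 hs)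
    have hη : 1 - α₁ ≤ m 3 * m 4 * y := by linarith
    have main := total_drift_le w (pos 0) (pos 1) (pos 2) (pos 3) (pos 4) (pos 5) hbal₁ hbal₂ hbal₃
      (hp 0) (hp' 0) (hp 1) (hp' 1) (hp 2) (hp' 2) hα'.le hy0.le
      (show m 0 * (1 - α₁) ≤ m 3 * y from calc
        m 0 * (1 - α₁) ≤ 1 * (1 - α₁) := by gcongr; linarith [pos 3]
        _ ≤ m 3 * m 4 * y := by linarith
        _ ≤ m 3 * y := by gcongr)
      (show m 1 * (1 - α₁) ≤ m 4 * y from calc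
        m 1 * (1 - α₁) ≤ 1 * (1 - α₁) := by gcongr; linarith [pos 4]
        _ ≤ m 3 * m 4 * y := by linarith
        _ ≤ m 4 * y := by gcongr)
      (show m 4 * y ≤ m 1 / 2 from calc
        m 4 * y ≤ 1 * y := by gcongr; linarith [pos 1]
        _ = m 1 / 2 * m 2 := by rw [hy]; ring
        _ ≤ m 1 / 2 := mul_le_of_le_one_right (half_pos (pos 1)).le (by linarith [pos 5]))
      (show m 5 * y ≤ m 2 / 2 from calc
        m 5 * y ≤ 1 * y := by gcongr; linarith [pos 2]
        _ = m 2 / 2 * m 1 := by rw [hy]; ring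
        _ ≤ m 2 / 2 := mul_le_of_le_one_right (half_pos (pos 2)).le (by linarith [pos 4]))
      r₁ r₂ r₃ (fun ⟨z₁, z₂, z₃⟩ => hpos.ne' (by simp [L, z₁, z₂, z₃, stationLyapunov]))
    rw [hL'.unique ((D₁.add D₂).add D₃)]
    exact (add_le_add (add_le_add b₁ b₂) b₃).trans main
  have ht0 : 0 ≤ t := (hL _ _).trans ht
  refine dhv_eq_of_excess_eq_zero hΔ fun j => ?_
  have g₁ := nn₁ (dhvExcess m Δ Z 0 t)
  have g₂ := nn₂ (dhvExcess m Δ Z 1 t)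
  have g₃ := nn₃ (dhvExcess m Δ Z 2 t)
  simp only [L] at hzero
  fin_cases j
  · exact dhvExcess_eq_zero_of_lyapunov sol hΔ hA₁ hB₁ 0 ht0 (by linarith)
  · exact dhvExcess_eq_zero_of_lyapunov sol hΔ hA₂ hB₂ 1 ht0 (by linarith)
  · exact dhvExcess_eq_zero_of_lyapunov sol hΔ hA₃ hB₃ 2 ht0 (by linarith)
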